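/- Let $N\ge 2$, let $X,Z$ be the Pauli matrices, $P_i=X$ for odd $i$ and $P_i=Z$ for even $i$, $k_{\min}(N)=\left\lceil\frac{1+\sqrt{8N-7}}{2}\right\rceil$, $k=k_{\min}(N)$ and $q_{\max}(i)=k_{\min}(N+i)-1$. Define the $N$-qubit operators $$G_i=\mathbb 1^{\otimes\frac{(i-1)(i-2)}2}\otimes P_i^{\otimes(i+1)}\otimes\bigotimes_{q=i+2}^{q_{\max}(i)}\left[\mathbb 1^{\otimes(q-3)}\otimes P_{q+1}^{\otimes2}\right]\otimes\mathbb 1\otimes\cdots\otimes\mathbb 1\quad(1\le i\le k-2),$$ $$G_{k-1}=\mathbb 1^{\otimes\frac{(k-2)(k-3)}2}\otimes P_{k-1}^{\otimes k}\otimes\mathbb 1\otimes\cdots\otimes\mathbb 1,\qquad G_k=\mathbb 1^{\otimes\frac{(k-1)(k-2)}2}\otimes P_k^{\otimes\left[N-\frac{(k-1)(k-2)}2\right]},$$ where the trailing identities fill up the $N$ sites, and let $V_N^{\max}=\{\psi\in(\mathbb C^2)^{\otimes N}: G_i\psi=\psi,\ i=1,\dots,k\}$. In the Bell scenario with $N$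 parties, each having two observables $A^{(i)}_0,A^{(i)}_1$ (Hermitian, with square $\mathbb 1$), a behaviour is the collection of all expectation values $\langle A^{(i_1)}_{x_1}\cdots A^{(i_r)}_{x_r}\rangle$ with $i_1<\dots<i_r$; it is quantum if these equal $\mathrm{Tr}[(A^{(i_1)}_{x_1}\otimes\cdots\otimes A^{(i_r)}_{x_r})\rho]$ for some density matrix $\rho$ on a product $\mathcal H_{P_1}\otimes\dots\otimes\mathcal H_{P_N}$ of finite-dimensional Hilbert spaces and some such observables. The Bell expression $I_N^{\max}$ is the sum over $i=1,\dots,k$ of the expectation values obtained from $G_i$ by the substitutions $X\to A^{(1)}_0+A^{(1)}_1$, $Z\to A^{(1)}_0-A^{(1)}_1$ at the first site and $X\to A^{(j)}_0$, $Z\to A^{(j)}_1$ at the sites $j=2,\dots,N$. Theorem. Every quantum behaviour at which $I_N^{\max}$ attains its maximum over all quantum behaviours self-tests the subspace $V_N^{\max}$. That is, let $|\phi\rangle_{PE}\in\mathcal H_{P_1}\otimes\cdots\otimes\mathcal H_{P_N}\otimes\mathcal H_E$ be any pure state, with finite-dimensional spaces, and let $A^{(i)}_{x}$ be any such observables of the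 parties, which together yield this behaviour. Then, after each $\mathcal H_{P_i}$ is replaced by the support of the reduced state $\rho_{P_i}$ (no replacement is needed if $\rho_{P_i}$ has full rank), there are finite-dimensional Hilbert spaces $\mathcal H''_{P_i}$ and unitary operators $U_i:\mathcal H_{P_i}\to\mathbb C^2\otimes\mathcal H''_{P_i}$ such that, for every orthonormal basis $(|\psi_j\rangle)$ of $V_N^{\max}$, $$(U_1\otimes\cdots\otimes U_N\otimes\mathbb 1_E)|\phi\rangle_{PE}=\sum_j\alpha_j\,|\psi_j\rangle_{P'}\otimes|\xi_j\rangle_{P''E}$$ for some $\alpha_j\ge0$ with $\sum_j\alpha_j^2=1$ and some unit vectors $|\xi_j\rangle\in\mathcal H''_{P_1}\otimes\cdots\otimes\mathcal H''_{P_N}\otimes\mathcal H_E$, where $P'$ denotes the $N$ qubits. -/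

import Mathlib

namespace SubspaceSelfTest

noncomputable section

open scoped Matrix Kronecker ComplexOrder

/-! ### The stabilizer subspace `V_N^max` -/

/-- The letters occurring in the stabilizing operators. -/
inductive Pauli : Type
  | I : Pauli
  | X : Pauli
  | Z : Pauli

/-- The corresponding `2 × 2` matrices. -/
def Pauli.toMatrix : Pauli → Matrix (Fin 2) (Fin 2) ℂ
  | .I => 1
  | .X => !![0, 1; 1, 0]
  | .Z => !![1, 0; 0, -1]

/-- `P_i` is `X` for odd `i` and `Z` for even `i`. -/
def altPauli (i : ℕ) : Pauli := if Odd i then .X else .Z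

/-- The number of generators, `k_min(N) = ⌈(1 + √(8N - 7)) / 2⌉`. -/
def kMin (N : ℕ) : ℕ := ⌈(1 + Real.sqrt (8 * (N : ℝ) - 7)) / 2⌉₊

/-- `q_max(i) = k_min(N + i) - 1`. -/
def qMax (N i : ℕ) : ℕ := kMin (N + i) - 1

/-- Site `p` (counted from `1`) belongs to the initial block of equal letters `P_i` of the `i`-th
generator: after `(i-1)(i-2)/2` identities there are `i + 1` letters `P_i` if `i < k_min(N)`, while
for `i = k_min(N)` the letters `P_i` fill all the remaining sites. -/
def InBlock (N i p : ℕ) : Prop :=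
  (i - 1) * (i - 2) / 2 < p ∧ (i < kMin N → p ≤ (i - 1) * (i - 2) / 2 + (i + 1))

/-- Site `p` (counted from `1`) carries one of the two letters `P_{q+1}` of the factor
`𝟙^{⊗(q-3)} ⊗ P_{q+1}^{⊗2}` of the `i`-th generator. These factors are present for
`i ≤ k_min(N) - 2` and `q = i+2, …, q_max(i)`, follow the initial block one after the other, and so
the two letters stand at the sites `q(q-1)/2 - i + 1` and `q(q-1)/2 - i + 2`. -/
def InPair (N i q p : ℕ) : Prop :=
  i + 2 ≤ kMin N ∧ i + 2 ≤ q ∧ q ≤ qMax N i ∧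
    (p + i = q * (q - 1) / 2 + 1 ∨ p + i = q * (q - 1) / 2 + 2)

open Classical in
/-- The generator `G_i^max` (`1 ≤ i ≤ k_min(N)`) as a string of letters; the site `p : Fin N` is
the site number `p + 1` when sites are counted from `1`. -/
def maxGen (N i : ℕ) (p : Fin N) : Pauli :=
  if InBlock N i (p.val + 1) then altPauli i
  else if ∃ q, InPair N i q (p.val + 1) ∧ Odd (q + 1) then .X
  else if ∃ q, InPair N i q (p.val + 1) ∧ Even (q + 1) then .Z
  else .I

/-- The tensor product `M_1 ⊗ … ⊗ M_N` of matrices, acting on `ℂ^{b_1} ⊗ … ⊗ ℂ^{b_N}`, which is the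
space of functions on `b_1 × … × b_N`. -/
def tensor {N : ℕ} {a b : Fin N → Type} (M : ∀ i, Matrix (a i) (b i) ℂ) :
    Matrix (∀ i, a i) (∀ i, b i) ℂ :=
  fun x y => ∏ i, M i (x i) (y i)

/-- `V_N^max`: the `N`-qubit vectors fixed by all the operators `G_i^max`. -/
def maxSubspace (N : ℕ) : Submodule ℂ (EuclideanSpace ℂ (Fin N → Fin 2)) :=
  ⨅ i ∈ Finset.Icc 1 (kMin N),
    Module.End.eigenspace (Matrix.toEuclideanLin (tensor fun p => (maxGen N i p).toMatrix)) 1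

/-! ### Correlations and the Bell expression -/

/-- A choice, for every party, of one of its two observables, or of none. -/
abbrev Setting (N : ℕ) : Type := Fin N → Option (Fin 2)

/-- A behaviour: all expectation values `⟨A_{x_1}^{(i_1)} ⋯ A_{x_k}^{(i_k)}⟩`; the parties that do
not occur in the correlator have the entry `none` in the setting. -/
abbrev Behaviour (N : ℕ) : Type := Setting N → ℝ

/-- A density matrix. -/
def IsDensity {ι : Type} [Fintype ι] (ρ : Matrix ι ι ℂ) : Prop :=
  ρ.PosSemidef ∧ ρ.trace = 1

/-- A dichotomic observable, with eigenvalues `±1`. -/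
def IsDichotomic {ι : Type} [Fintype ι] [DecidableEq ι] (A : Matrix ι ι ℂ) : Prop :=
  A.IsHermitian ∧ A * A = 1

/-- The observable measured by one party; the identity if the party is left out. -/
def measured {ι : Type} [DecidableEq ι] (A : Fin 2 → Matrix ι ι ℂ) :
    Option (Fin 2) → Matrix ι ι ℂ
  | none => 1
  | some x => A x

/-- The behaviour `Tr[(A_{x_1}^{(i_1)} ⊗ ⋯ ⊗ A_{x_k}^{(i_k)}) ρ]`. -/
def correlations {N : ℕ} {d : Fin N → ℕ}
    (ρ : Matrix (∀ i, Fin (d i)) (∀ i, Fin (d i)) ℂ)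
    (A : ∀ i, Fin 2 → Matrix (Fin (d i)) (Fin (d i)) ℂ) : Behaviour N :=
  fun s => (((tensor fun i => measured (A i) (s i)) * ρ).trace).re

/-- The set `Q_N` of quantum correlations: all behaviours obtained from a (mixed) state on
`ℂ^{d_1} ⊗ ⋯ ⊗ ℂ^{d_N}`, for any finite dimensions, and two dichotomic observables per party. -/
def quantumSet (N : ℕ) : Set (Behaviour N) :=
  {P | ∃ (d : Fin N → ℕ) (ρ : Matrix (∀ i, Fin (d i)) (∀ i, Fin (d i)) ℂ)
    (A : ∀ i, Fin 2 → Matrix (Fin (d i)) (Fin (d i)) ℂ),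
    IsDensity ρ ∧ (∀ i x, IsDichotomic (A i x)) ∧ correlations ρ A = P}

/-- The substitution of observables for letters: `siteCoeff i L s` is the coefficient of the
observable `s` of party `i` (of the identity, for `s = none`) in what replaces the letter `L`. For
the first party `X ↦ A_0 + A_1` and `Z ↦ A_0 - A_1`, for the others `X ↦ A_0` and `Z ↦ A_1`. -/
def siteCoeff {N : ℕ} (i : Fin N) : Pauli → Option (Fin 2) → ℝ
  | .I, none => 1
  | .I, some _ => 0
  | .X, none => 0
  | .X, some x => if i.val = 0 then 1 else if x = 0 then 1 else 0
  | .Z, none => 0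
  | .Z, some x => if i.val = 0 then (if x = 0 then 1 else -1) else if x = 1 then 1 else 0

/-- The combination of expectation values associated to a string of letters: the product of the
substituted combinations of observables, expanded multilinearly. -/
def bellTerm {N : ℕ} (g : Fin N → Pauli) (P : Behaviour N) : ℝ :=
  ∑ s : Setting N, (∏ i, siteCoeff i (g i) (s i)) * P s

/-- The Bell expression `I_N^max`: one term for every generator `G_i^max`. -/
def bellExpr (N : ℕ) (P : Behaviour N) : ℝ :=
  ∑ i ∈ Finset.Icc 1 (kMin N), bellTerm (maxGen N i) P

/-! ### Self-testing of a subspace -/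

/-- The reduced state `ρ_P = Tr_E |φ⟩⟨φ|` of a vector `φ` of `H_P ⊗ H_E`. -/
def reducedState {p : Type} {e : ℕ} (φ : EuclideanSpace ℂ (p × Fin e)) : Matrix p p ℂ :=
  fun x y => ∑ c, φ (x, c) * star (φ (y, c))

/-- The reduced state of party `i`, the partial trace over all other parties. -/
def localState {N : ℕ} {d : Fin N → ℕ} (ρ : Matrix (∀ i, Fin (d i)) (∀ i, Fin (d i)) ℂ)
    (i : Fin N) : Matrix (Fin (d i)) (Fin (d i)) ℂ :=
  fun a b => ∑ x ∈ Finset.univ.filter (fun x : ∀ j, Fin (d j) => x i = a),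
    ρ x (Function.update x i b)

/-- `U` restricts to a unitary operator from the support (the range) of `ρ` onto `ℂ² ⊗ ℂ^n`, and
vanishes on the orthogonal complement of the support. If `ρ` has full rank, this says that `U` is
unitary from `ℂ^d` onto `ℂ² ⊗ ℂ^n`. -/
def IsUnitaryOnSupport {d n : ℕ} (U : Matrix (Fin 2 × Fin n) (Fin d) ℂ)
    (ρ : Matrix (Fin d) (Fin d) ℂ) : Prop :=
  U * Uᴴ = 1 ∧ LinearMap.range (Uᴴ).mulVecLin = LinearMap.range ρ.mulVecLin

/-- `ψ ⊗ ξ` for `ψ` in `H_{P'} = (ℂ²)^{⊗N}` and `ξ` in `H_{P''} ⊗ H_E`, as a vector of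
`(⨂_i (ℂ² ⊗ ℂ^{n_i})) ⊗ H_E`. -/
def prodState {N e : ℕ} {n : Fin N → ℕ} (ψ : EuclideanSpace ℂ (Fin N → Fin 2))
    (ξ : EuclideanSpace ℂ ((∀ i, Fin (n i)) × Fin e)) :
    EuclideanSpace ℂ ((∀ i, Fin 2 × Fin (n i)) × Fin e) :=
  WithLp.toLp 2 fun y => ψ (fun i => (y.1 i).1) * ξ (fun i => (y.1 i).2, y.2)

/-- The behaviour `P` self-tests the subspace `V` of `(ℂ²)^{⊗N}`: for every pure state `φ` of
`H_P ⊗ H_E` and all dichotomic observables with which it yields `P`, there are local unitaries `U_i`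
identifying each local Hilbert space (the support of the reduced state of the party, which is all
of `ℂ^{d_i}` when that state has full rank) with `ℂ² ⊗ ℂ^{n_i}`, such that, for every orthonormal
basis `ψ_j` of `V`, `(U_1 ⊗ ⋯ ⊗ U_N ⊗ 𝟙_E) φ = ∑_j α_j ψ_j ⊗ ξ_j` with `α_j ≥ 0`, `∑_j α_j² = 1`
and unit vectors `ξ_j` of `H_{P''} ⊗ H_E`. -/
def SelfTests {N : ℕ} (P : Behaviour N) (V : Submodule ℂ (EuclideanSpace ℂ (Fin N → Fin 2))) :
    Prop :=
  ∀ (d : Fin N → ℕ) (e : ℕ) (φ : EuclideanSpace ℂ ((∀ i, Fin (d i)) × Fin e))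
    (A : ∀ i, Fin 2 → Matrix (Fin (d i)) (Fin (d i)) ℂ),
    ‖φ‖ = 1 → (∀ i x, IsDichotomic (A i x)) → correlations (reducedState φ) A = P →
    ∃ (n : Fin N → ℕ) (U : ∀ i, Matrix (Fin 2 × Fin (n i)) (Fin (d i)) ℂ),
      (∀ i, IsUnitaryOnSupport (U i) (localState (reducedState φ) i)) ∧
      ∀ (m : ℕ) (ψ : Fin m → EuclideanSpace ℂ (Fin N → Fin 2)),
        Orthonormal ℂ ψ → Submodule.span ℂ (Set.range ψ) = V →
        ∃ (α : Fin m → ℝ) (ξ : Fin m → EuclideanSpace ℂ ((∀ i, Fin (n i)) × Fin e)),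
          (∀ j, 0 ≤ α j) ∧ ∑ j, α j ^ 2 = 1 ∧ (∀ j, ‖ξ j‖ = 1) ∧
          Matrix.toEuclideanLin (tensor U ⊗ₖ (1 : Matrix (Fin e) (Fin e) ℂ)) φ =
            ∑ j, (α j : ℂ) • prodState (ψ j) (ξ j)

end

end SubspaceSelfTest

/-!
The value of the Bell expression on a quantum strategy is governed by a sum of squares. For the
first party put `X̃ = (A_0 + A_1) / √2` and `Z̃ = (A_0 - A_1) / √2`, for the others `X = A_0` and
`Z = A_1` (`letterOp`). Then `X̃² + Z̃² = 2`, only `G_1` and `G_2` act on the first party, and the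
squares `‖G_i φ - φ‖²`, with weight `√2` for `i ≤ 2` and `1` otherwise, add up to twice the distance
of the Bell expression from the sum of the weights (`sum_weighted_sq`). This sum is attained by a
state of the stabilizer subspace and suitable qubit observables (`exists_quantum_bellExpr_eq`),
because the generators have a common fixed vector (`exists_fixed_vector`). So at a maximum all the
`G_i` fix the state (`genObs_mul_eq_self`).

What makes the subspace self-testable is the combinatorics of the generators: two of them carry
different letters `X`, `Z` at exactly two neighbouring sites or nowhere (`clash_maxGen_iff`), so
they commute; and, since every natural number is `j (j - 1) / 2 - i + 1` for some `1 ≤ i < j`, or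
zero, every pair of neighbouring sites is obtained from two generators (`exists_clash_iff`). In
particular each site sees both letters, whose operators act on the state as operators of the other
parties, and hence preserve the support of the reduced state (`letterOp_preserves_support`). On the
supports they are involutions, which anticommute at the first site by construction. If `G_i` and
`G_j` differ at the sites `s` and `s + 1` only, then `(G_i G_j)² φ = φ` carries anticommutation from
`s` to `s + 1` (`anticommute_of_clash`), hence to all sites. Anticommuting involutions are Pauli
matrices on a tensor factor `ℂ²` (`exists_unitary_of_anticommute`). The local unitaries so obtained
map the state to one fixed by the actual generators, all of whose qubit components lie in the
stabilizer subspace; expanding these in an orthonormal basis gives the claim (`exists_expansion`).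

A vector `φ` of `H_P ⊗ H_E` is treated as a matrix `Φ` with rows indexed by the basis of `H_P` and
columns by that of `H_E`: then `(M ⊗ 1) φ` is `M * Φ` and the reduced state is `Φ * Φᴴ`.
-/

namespace SubspaceSelfTest

open scoped Matrix Kronecker ComplexOrder

/-! ### Tensor products of matrices and local operators -/

section Tensor

variable {N : ℕ} {a b c : Fin N → Type}

lemma tensor_mul [∀ i, Fintype (b i)] (A : ∀ i, Matrix (a i) (b i) ℂ)
    (B : ∀ i, Matrix (b i) (c i) ℂ) :
    tensor A * tensor B = tensor fun i => A i * B i := by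
  ext x z
  simp only [Matrix.mul_apply, tensor, ← Finset.prod_mul_distrib]
  rw [Finset.prod_univ_sum, Fintype.piFinset_univ]

lemma tensor_one [∀ i, DecidableEq (a i)] :
    tensor (fun i => (1 : Matrix (a i) (a i) ℂ)) = 1 := by
  ext x y
  simp only [tensor, Matrix.one_apply, Fintype.prod_ite_zero, Finset.prod_const_one,
    funext_iff]

lemma tensor_conjTranspose (A : ∀ i, Matrix (a i) (b i) ℂ) :
    (tensor A)ᴴ = tensor fun i => (A i)ᴴ := by
  ext x y
  simp [tensor, Matrix.conjTranspose_apply]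

lemma tensor_smul (r : Fin N → ℂ) (A : ∀ i, Matrix (a i) (b i) ℂ) :
    tensor (fun i => r i • A i) = (∏ i, r i) • tensor A := by
  ext x y
  simp [tensor, Finset.prod_mul_distrib]

lemma tensor_sum {ι : Type} [Fintype ι] (A : ∀ i, ι → Matrix (a i) (b i) ℂ) :
    tensor (fun i => ∑ s, A i s) = ∑ s : Fin N → ι, tensor fun i => A i (s i) := by
  ext x y
  simp only [tensor, Matrix.sum_apply]
  rw [Finset.prod_univ_sum, Fintype.piFinset_univ]

lemma tensor_update (A : ∀ i, Matrix (a i) (b i) ℂ) (p : Fin N) (M : Matrix (a p) (b p) ℂ)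
    (x : ∀ i, a i) (y : ∀ i, b i) :
    tensor (Function.update A p M) x y =
      M (x p) (y p) * ∏ i ∈ Finset.univ.erase p, A i (x i) (y i) := by
  rw [tensor, ← Finset.mul_prod_erase _ _ (Finset.mem_univ p), Function.update_self]
  congr 1
  refine Finset.prod_congr rfl fun i hi => ?_
  rw [Function.update_of_ne (Finset.ne_of_mem_erase hi)]

variable [∀ i, DecidableEq (a i)]

/-- The operator `M` of the site `p`, acting as the identity on all the other sites. -/
noncomputable def siteOp (p : Fin N) (M : Matrix (a p) (a p) ℂ) :
    Matrix (∀ i, a i) (∀ i, a i) ℂ :=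
  tensor (Function.update (fun i => (1 : Matrix (a i) (a i) ℂ)) p M)

lemma siteOp_apply (p : Fin N) (M : Matrix (a p) (a p) ℂ) (x y : ∀ i, a i) :
    siteOp p M x y = if ∀ i, i ≠ p → x i = y i then M (x p) (y p) else 0 := by
  rw [siteOp, tensor_update]
  simp only [Matrix.one_apply, Finset.prod_ite_zero, Finset.prod_const_one, Finset.mem_erase,
    Finset.mem_univ, and_true, mul_ite, mul_one, mul_zero]

lemma siteOp_one (p : Fin N) : siteOp p (1 : Matrix (a p) (a p) ℂ) = 1 := by
  rw [siteOp, Function.update_eq_self p (fun i => (1 : Matrix (a i) (a i) ℂ)), tensor_one]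

lemma siteOp_add (p : Fin N) (A B : Matrix (a p) (a p) ℂ) :
    siteOp p (A + B) = siteOp p A + siteOp p B := by
  ext x y
  simp only [siteOp_apply, Matrix.add_apply]
  split_ifs <;> simp

lemma siteOp_neg (p : Fin N) (A : Matrix (a p) (a p) ℂ) :
    siteOp p (-A) = - siteOp p A := by
  ext x y
  simp only [siteOp_apply, Matrix.neg_apply]
  split_ifs <;> simp

lemma siteOp_sub (p : Fin N) (A B : Matrix (a p) (a p) ℂ) :
    siteOp p (A - B) = siteOp p A - siteOp p B := by
  rw [sub_eq_add_neg, siteOp_add, siteOp_neg, sub_eq_add_neg]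

lemma siteOp_conjTranspose (p : Fin N) (A : Matrix (a p) (a p) ℂ) :
    (siteOp p A)ᴴ = siteOp p Aᴴ := by
  ext x y
  simp only [siteOp_apply, Matrix.conjTranspose_apply, eq_comm (a := y _)]
  split_ifs <;> simp

variable [∀ i, Fintype (a i)]

lemma siteOp_mul_tensor (p : Fin N) (M : Matrix (a p) (a p) ℂ) (A : ∀ i, Matrix (a i) (b i) ℂ) :
    siteOp p M * tensor A = tensor (Function.update A p (M * A p)) := by
  rw [siteOp, tensor_mul]
  congr 1
  funext i
  rcases eq_or_ne i p with rfl | h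
  · simp
  · simp [h]

lemma tensor_mul_siteOp (p : Fin N) (M : Matrix (a p) (a p) ℂ) (A : ∀ i, Matrix (b i) (a i) ℂ) :
    tensor A * siteOp p M = tensor (Function.update A p (A p * M)) := by
  rw [siteOp, tensor_mul]
  congr 1
  funext i
  rcases eq_or_ne i p with rfl | h
  · simp
  · simp [h]

lemma siteOp_mul (p : Fin N) (A B : Matrix (a p) (a p) ℂ) :
    siteOp p A * siteOp p B = siteOp p (A * B) := by
  conv_lhs => rw [siteOp.eq_def p B, siteOp_mul_tensor]
  simp [siteOp]

/-- Separating the factor of the site `p` from the others. -/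
lemma tensor_eq_siteOp_mul (p : Fin N) (A : ∀ i, Matrix (a i) (a i) ℂ) :
    tensor A = siteOp p (A p) * tensor (Function.update A p 1) := by
  rw [siteOp_mul_tensor]
  simp

lemma siteOp_comm_tensor (p : Fin N) (M : Matrix (a p) (a p) ℂ) (A : ∀ i, Matrix (a i) (a i) ℂ) :
    siteOp p M * tensor (Function.update A p 1) = tensor (Function.update A p 1) * siteOp p M := by
  rw [siteOp_mul_tensor, tensor_mul_siteOp]
  simp

/-- A vector fixed by the operators `Q_i` of the single sites is fixed by their tensor product. -/
lemma tensor_mul_eq_self {E : Type} (Q : ∀ i, Matrix (a i) (a i) ℂ)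
    (Φ : Matrix (∀ i, a i) E ℂ) (h : ∀ i, siteOp i (Q i) * Φ = Φ) : tensor Q * Φ = Φ := by
  have key : ∀ s : Finset (Fin N), tensor (fun i => if i ∈ s then Q i else 1) * Φ = Φ := by
    intro s
    induction s using Finset.induction_on with
    | empty => simp [tensor_one]
    | insert p s hp ih =>
      have : tensor (fun i => if i ∈ insert p s then Q i else 1) =
          siteOp p (Q p) * tensor (fun i => if i ∈ s then Q i else 1) := by
        rw [siteOp_mul_tensor]
        congr 1
        funext i
        rcases eq_or_ne i p with rfl | hi
        · simp [hp]
        · simp [hi]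
      rw [this, Matrix.mul_assoc, ih, h]
  simpa using key Finset.univ

end Tensor

/-! ### Reduced states of single sites -/

section LocalState

variable {N : ℕ} {d : Fin N → ℕ}

lemma siteOp_mul_apply {E : Type} (p : Fin N) (M : Matrix (Fin (d p)) (Fin (d p)) ℂ)
    (ρ : Matrix (∀ i, Fin (d i)) E ℂ) (x : ∀ i, Fin (d i)) (y : E) :
    (siteOp (a := fun i => Fin (d i)) p M * ρ) x y =
      ∑ c, M (x p) c * ρ (Function.update x p c) y := by
  rw [Matrix.mul_apply]
  simp only [siteOp_apply, ite_mul, zero_mul]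
  rw [← Finset.sum_filter]
  refine Finset.sum_bij' (fun z _ => z p) (fun c _ => Function.update x p c) ?_ ?_ ?_ ?_ ?_
  · simp
  · intro c _
    simp +contextual [Function.update_of_ne]
  · intro z hz
    simp only [Finset.mem_filter, Finset.mem_univ, true_and] at hz
    funext i
    rcases eq_or_ne i p with rfl | hi
    · simp
    · simp [hi, hz i hi]
  · simp
  · intro z hz
    simp only [Finset.mem_filter, Finset.mem_univ, true_and] at hz
    congr 2
    funext i
    rcases eq_or_ne i p with rfl | hi
    · simp
    · simp [hi, hz i hi]

lemma localState_siteOp_mul (ρ : Matrix (∀ i, Fin (d i)) (∀ i, Fin (d i)) ℂ) (p : Fin N)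
    (M : Matrix (Fin (d p)) (Fin (d p)) ℂ) :
    localState (siteOp (a := fun i => Fin (d i)) p M * ρ) p = M * localState ρ p := by
  ext a b
  simp only [localState, Matrix.mul_apply (M := M), siteOp_mul_apply, Finset.mul_sum]
  rw [Finset.sum_comm]
  refine Finset.sum_congr rfl fun c _ => ?_
  refine Finset.sum_bij' (fun x _ => Function.update x p c) (fun x _ => Function.update x p a)
    ?_ ?_ ?_ ?_ ?_
  · simp
  · simp
  · intro x hx
    simp only [Finset.mem_filter, Finset.mem_univ, true_and] at hx
    simp [← hx]
  · intro x hx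
    simp only [Finset.mem_filter, Finset.mem_univ, true_and] at hx
    simp [← hx]
  · intro x hx
    simp only [Finset.mem_filter, Finset.mem_univ, true_and] at hx
    simp [hx]

lemma trace_localState (ρ : Matrix (∀ i, Fin (d i)) (∀ i, Fin (d i)) ℂ) (p : Fin N) :
    (localState ρ p).trace = ρ.trace := by
  simp only [Matrix.trace, Matrix.diag, localState]
  rw [← Finset.sum_fiberwise (s := Finset.univ) (g := fun x : ∀ i, Fin (d i) => x p)
    (f := fun x => ρ x x)]
  refine Finset.sum_congr rfl fun a _ => Finset.sum_congr rfl fun x hx => ?_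
  simp only [Finset.mem_filter, Finset.mem_univ, true_and] at hx
  simp [← hx]

/-- A local operator annihilates a pure state if and only if it annihilates the reduced state of
its party. -/
lemma siteOp_mul_eq_zero_iff {E : Type} [Fintype E] (Φ : Matrix (∀ i, Fin (d i)) E ℂ)
    (p : Fin N) (Q : Matrix (Fin (d p)) (Fin (d p)) ℂ) :
    siteOp (a := fun i => Fin (d i)) p Q * Φ = 0 ↔ Q * localState (Φ * Φᴴ) p = 0 := by
  constructor
  · intro h
    rw [← localState_siteOp_mul, ← Matrix.mul_assoc, h, Matrix.zero_mul]
    ext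
    simp [localState]
  · intro h
    rw [← Matrix.trace_conjTranspose_mul_self_eq_zero_iff, Matrix.conjTranspose_mul,
      Matrix.mul_assoc, Matrix.trace_mul_comm, siteOp_conjTranspose,
      ← Matrix.mul_assoc, siteOp_mul, Matrix.mul_assoc, ← trace_localState _ p,
      localState_siteOp_mul, Matrix.mul_assoc, h]
    simp

/-- A local operator fixes a pure state if and only if it fixes the reduced state of its party. -/
lemma siteOp_mul_eq_self_iff {E : Type} [Fintype E] (Φ : Matrix (∀ i, Fin (d i)) E ℂ)
    (p : Fin N) (Q : Matrix (Fin (d p)) (Fin (d p)) ℂ) :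
    siteOp (a := fun i => Fin (d i)) p Q * Φ = Φ ↔
      Q * localState (Φ * Φᴴ) p = localState (Φ * Φᴴ) p := by
  have := siteOp_mul_eq_zero_iff Φ p (Q - 1)
  rwa [siteOp_sub, siteOp_one, Matrix.sub_mul, Matrix.sub_mul, Matrix.one_mul, Matrix.one_mul,
    sub_eq_zero, sub_eq_zero] at this

end LocalState

/-! ### Isometries and pairs of anticommuting observables -/

section Isometry

lemma exists_isometry_range_eq {d : ℕ} (K : Submodule ℂ (Fin d → ℂ)) :
    ∃ (n : ℕ) (W : Matrix (Fin d) (Fin n) ℂ), Wᴴ * W = 1 ∧ LinearMap.range W.mulVecLin = K := by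
  let e := WithLp.linearEquiv 2 ℂ (Fin d → ℂ)
  let K' : Submodule ℂ (EuclideanSpace ℂ (Fin d)) := K.comap e.toLinearMap
  let b := stdOrthonormalBasis ℂ K'
  refine ⟨_, Matrix.of fun x j => (b j : EuclideanSpace ℂ (Fin d)) x, ?_, ?_⟩
  · ext i j
    have h := orthonormal_iff_ite.1 b.orthonormal i j
    rw [Submodule.coe_inner, PiLp.inner_apply] at h
    simp only [RCLike.inner_apply] at h
    simp only [Matrix.mul_apply, Matrix.conjTranspose_apply, Matrix.of_apply, Matrix.one_apply,
      ← h]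
    exact Finset.sum_congr rfl fun x _ => mul_comm _ _
  · rw [Matrix.range_mulVecLin]
    have h1 : Submodule.span ℂ (Set.range b) = ⊤ := by
      simpa using b.toBasis.span_eq
    have h2 : Submodule.map (e.toLinearMap ∘ₗ K'.subtype) ⊤ = K := by
      rw [Submodule.map_comp, Submodule.map_top, Submodule.range_subtype]
      exact Submodule.map_comap_eq_of_surjective e.surjective K
    rw [← h2, ← h1, Submodule.map_span, ← Set.range_comp]
    rfl

lemma exists_eq_mul_of_range_le {m n d : ℕ} {M : Matrix (Fin d) (Fin m) ℂ}
    {W : Matrix (Fin d) (Fin n) ℂ}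
    (h : LinearMap.range M.mulVecLin ≤ LinearMap.range W.mulVecLin) :
    ∃ C : Matrix (Fin n) (Fin m) ℂ, M = W * C := by
  have h' : ∀ j, ∃ v, W.mulVec v = M.col j := fun j => by
    obtain ⟨v, hv⟩ := h ⟨Pi.single j 1, rfl⟩
    exact ⟨v, by simpa using hv⟩
  choose v hv using h'
  refine ⟨Matrix.of fun i j => v j i, ?_⟩
  ext i j
  exact (congrFun (hv j) i).symm

lemma mul_conjTranspose_mul_of_range_le {m n d : ℕ} {M : Matrix (Fin d) (Fin m) ℂ}
    {W : Matrix (Fin d) (Fin n) ℂ} (hW : Wᴴ * W = 1)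
    (h : LinearMap.range M.mulVecLin ≤ LinearMap.range W.mulVecLin) : W * Wᴴ * M = M := by
  obtain ⟨C, rfl⟩ := exists_eq_mul_of_range_le h
  rw [Matrix.mul_assoc, ← Matrix.mul_assoc Wᴴ, hW, Matrix.one_mul]

/-- An orthogonal projector is `B Bᴴ` for an isometry `B`. -/
lemma exists_isometry_of_projector {d : ℕ} {Q : Matrix (Fin d) (Fin d) ℂ} (hQ : Qᴴ = Q)
    (hQQ : Q * Q = Q) :
    ∃ (n : ℕ) (B : Matrix (Fin d) (Fin n) ℂ), Bᴴ * B = 1 ∧ B * Bᴴ = Q := by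
  obtain ⟨n, B, hB, hr⟩ := exists_isometry_range_eq (LinearMap.range Q.mulVecLin)
  refine ⟨n, B, hB, ?_⟩
  have h1 := mul_conjTranspose_mul_of_range_le hB hr.ge
  obtain ⟨C, hC⟩ := exists_eq_mul_of_range_le hr.le
  have h2 : Q * B = B := by rw [hC, ← Matrix.mul_assoc, hQQ]
  calc B * Bᴴ = Q * (B * Bᴴ) := by rw [← Matrix.mul_assoc, h2]
    _ = (B * Bᴴ * Q)ᴴ := by simp [Matrix.conjTranspose_mul, hQ, Matrix.mul_assoc]
    _ = Q := by rw [h1, hQ]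

/-- If `L` is an involution on the range of `ρ` and preserves this range, its compression to the
range is an involution, and the compression is a restriction. -/
lemma compression_spec {d n : ℕ} {ρ L : Matrix (Fin d) (Fin d) ℂ} {W : Matrix (Fin d) (Fin n) ℂ}
    (hW : Wᴴ * W = 1) (hr : LinearMap.range W.mulVecLin = LinearMap.range ρ.mulVecLin)
    (hsq : L * L * ρ = ρ) (hpres : W * Wᴴ * (L * ρ) = L * ρ) :
    W * (Wᴴ * L * W) = L * W ∧ (Wᴴ * L * W) * (Wᴴ * L * W) = 1 := by
  obtain ⟨C, hC⟩ := exists_eq_mul_of_range_le hr.le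
  have h1 : W * (Wᴴ * L * W) = L * W := by
    calc W * (Wᴴ * L * W) = W * Wᴴ * (L * ρ) * C := by
          nth_rewrite 3 [hC]; simp only [Matrix.mul_assoc]
      _ = L * W := by rw [hpres, Matrix.mul_assoc, ← hC]
  refine ⟨h1, ?_⟩
  calc (Wᴴ * L * W) * (Wᴴ * L * W) = Wᴴ * (L * (W * (Wᴴ * L * W))) := by
        simp only [Matrix.mul_assoc]
    _ = Wᴴ * (L * L * ρ * C) := by rw [h1, hC]; simp only [Matrix.mul_assoc]
    _ = 1 := by rw [hsq, ← hC, hW]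

/-- Two anticommuting observables are the Pauli matrices `X` and `Z` of a qubit, up to a unitary:
`ℂ^r` is the direct sum of the two eigenspaces of `Z`, and `X` exchanges them. -/
lemma exists_unitary_of_anticommute {r : ℕ} {X Z : Matrix (Fin r) (Fin r) ℂ} (hX : Xᴴ = X)
    (hZ : Zᴴ = Z) (hXX : X * X = 1) (hZZ : Z * Z = 1) (hXZ : X * Z = -(Z * X)) :
    ∃ (n : ℕ) (V : Matrix (Fin 2 × Fin n) (Fin r) ℂ), V * Vᴴ = 1 ∧ Vᴴ * V = 1 ∧
      V * X = (Pauli.X.toMatrix ⊗ₖ (1 : Matrix (Fin n) (Fin n) ℂ)) * V ∧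
      V * Z = (Pauli.Z.toMatrix ⊗ₖ (1 : Matrix (Fin n) (Fin n) ℂ)) * V := by
  obtain ⟨n, B, hB, hBB⟩ := exists_isometry_of_projector (Q := (1 / 2 : ℂ) • (1 + Z))
    (by simp [Matrix.conjTranspose_add, hZ])
    (by
      rw [Matrix.smul_mul, Matrix.mul_smul, smul_smul, Matrix.mul_add, Matrix.add_mul,
        Matrix.add_mul, hZZ]
      simp only [Matrix.mul_one, Matrix.one_mul]
      rw [add_comm Z 1, ← two_smul ℂ, smul_smul]
      norm_num)
  have hZB : Z * B = B := by
    have h : Z * (B * Bᴴ) = B * Bᴴ := by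
      rw [hBB, Matrix.mul_smul, Matrix.mul_add, hZZ, Matrix.mul_one, add_comm]
    calc Z * B = Z * (B * Bᴴ) * B := by
          rw [Matrix.mul_assoc, Matrix.mul_assoc, hB, Matrix.mul_one]
      _ = B := by rw [h, Matrix.mul_assoc, hB, Matrix.mul_one]
  have hBZ : Bᴴ * Z = Bᴴ := by
    rw [← hZ, ← Matrix.conjTranspose_mul, hZB]
  have hBXB : Bᴴ * X * B = 0 := by
    have h : Bᴴ * X * B = -(Bᴴ * X * B) := by
      calc Bᴴ * X * B = Bᴴ * (X * Z) * B := by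
            rw [Matrix.mul_assoc, Matrix.mul_assoc, Matrix.mul_assoc, hZB]
        _ = -(Bᴴ * X * B) := by
            rw [hXZ, Matrix.mul_neg, Matrix.neg_mul, ← Matrix.mul_assoc, hBZ]
    ext x y
    exact self_eq_neg.1 (congrFun (congrFun h x) y)
  let R : Fin 2 → Matrix (Fin n) (Fin r) ℂ := ![Bᴴ, Bᴴ * X]
  let V : Matrix (Fin 2 × Fin n) (Fin r) ℂ := Matrix.of fun i j => R i.1 i.2 j
  have hVM : ∀ M : Matrix (Fin r) (Fin r) ℂ, ∀ i j, (V * M) i j = (R i.1 * M) i.2 j :=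
    fun _ _ _ => rfl
  have hσV : ∀ (σ : Matrix (Fin 2) (Fin 2) ℂ) (i : Fin 2 × Fin n) (j : Fin r),
      ((σ ⊗ₖ (1 : Matrix (Fin n) (Fin n) ℂ)) * V) i j = ∑ b, σ i.1 b * R b i.2 j := by
    intro σ i j
    rw [Matrix.mul_apply, Fintype.sum_prod_type]
    refine Finset.sum_congr rfl fun b _ => ?_
    simp [Matrix.kroneckerMap_apply, Matrix.one_apply, V]
  refine ⟨n, V, ?_, ?_, ?_, ?_⟩
  · have h : ∀ s t : Fin 2, R s * (R t)ᴴ = if s = t then 1 else 0 := by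
      intro s t
      fin_cases s <;> fin_cases t
      · simp [R, hB]
      · simpa [R, Matrix.conjTranspose_mul, hX, Matrix.mul_assoc] using hBXB
      · simpa [R] using hBXB
      · simp only [R, Matrix.cons_val_one, Matrix.conjTranspose_mul, hX, Fin.mk_one, if_true,
          Matrix.conjTranspose_conjTranspose, Matrix.cons_val_fin_one]
        rw [Matrix.mul_assoc, ← Matrix.mul_assoc X, hXX, Matrix.one_mul, hB]
    ext ⟨s, x⟩ ⟨t, y⟩
    have : (V * Vᴴ) (s, x) (t, y) = (R s * (R t)ᴴ) x y := rfl
    rw [this, h]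
    by_cases hst : s = t <;> simp [hst, Matrix.one_apply]
  · have : Vᴴ * V = (R 0)ᴴ * R 0 + (R 1)ᴴ * R 1 := by
      ext x y
      rw [Matrix.mul_apply, Fintype.sum_prod_type, Fin.sum_univ_two]
      rfl
    rw [this]
    simp only [R, Matrix.cons_val_zero, Matrix.cons_val_one, Matrix.conjTranspose_mul, hX,
      Matrix.conjTranspose_conjTranspose, Matrix.cons_val_fin_one]
    rw [Matrix.mul_assoc, ← Matrix.mul_assoc B, hBB]
    have h2 : X * ((1 / 2 : ℂ) • (1 + Z) * X) = (1 / 2 : ℂ) • (1 - Z) := by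
      rw [Matrix.smul_mul, Matrix.mul_smul, Matrix.add_mul, Matrix.mul_add, Matrix.one_mul, hXX,
        ← Matrix.mul_assoc, hXZ, Matrix.neg_mul, Matrix.mul_assoc, hXX, Matrix.mul_one,
        sub_eq_add_neg]
    rw [h2, ← smul_add, add_add_sub_cancel, ← two_smul ℂ, smul_smul]
    norm_num
  · ext ⟨s, x⟩ j
    rw [hVM, hσV, Fin.sum_univ_two]
    fin_cases s
    · simp [R, Pauli.toMatrix]
    · simp [R, Pauli.toMatrix, Matrix.mul_assoc, hXX]
  · ext ⟨s, x⟩ j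
    rw [hVM, hσV, Fin.sum_univ_two]
    fin_cases s
    · simp [R, Pauli.toMatrix, hBZ]
    · simp [R, Pauli.toMatrix, Matrix.mul_assoc, hXZ]
      rw [← Matrix.mul_assoc, hBZ]

end Isometry

/-! ### The sites at which two generators carry different letters -/

section Combinatorics

/-- The triangular numbers `j (j - 1) / 2`. -/
def tri (j : ℕ) : ℕ := j * (j - 1) / 2

lemma tri_succ (j : ℕ) : tri (j + 1) = tri j + j := by
  have := Nat.triangle_succ j
  simpa [tri] using this

lemma tri_pred (j : ℕ) : (j - 1) * (j - 2) / 2 = tri (j - 1) := by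
  rw [tri, Nat.sub_sub]

lemma tri_mono {a b : ℕ} (h : a ≤ b) : tri a ≤ tri b := by
  induction b, h using Nat.le_induction with
  | base => exact le_rfl
  | succ b _ ih => rw [tri_succ]; omega

lemma tri_add_le {a b : ℕ} (h : a < b) : tri a + a ≤ tri b := by
  rw [← tri_succ]
  exact tri_mono h

lemma lt_kMin_iff {N q : ℕ} (hN : 2 ≤ N) : q < kMin N ↔ tri q + 1 < N := by
  have hN' : (2 : ℝ) ≤ N := by exact_mod_cast hN
  rw [kMin, Nat.lt_ceil, lt_div_iff₀ two_pos]
  have e : (q : ℝ) * 2 < 1 + √(8 * N - 7) ↔ 2 * (q : ℝ) - 1 < √(8 * N - 7) := by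
    constructor <;> intro h <;> linarith
  rw [e]
  rcases Nat.eq_zero_or_pos q with rfl | hq
  · have h0 := Real.sqrt_nonneg (8 * (N : ℝ) - 7)
    simp only [tri]
    refine iff_of_true ?_ (by omega)
    push_cast
    linarith
  · have hq' : (1 : ℝ) ≤ q := by exact_mod_cast hq
    rw [Real.lt_sqrt (by linarith)]
    have ht : 2 * tri q = q * (q - 1) :=
      Nat.mul_div_cancel' (even_iff_two_dvd.1 (Nat.even_mul_pred_self q))
    have ht' : 2 * (tri q : ℝ) = q * (q - 1) := by
      rw [← Nat.cast_pred hq]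
      exact_mod_cast ht
    rw [← Nat.cast_lt (α := ℝ)]
    push_cast
    constructor <;> intro h <;> nlinarith

lemma two_le_kMin {N : ℕ} (hN : 2 ≤ N) : 2 ≤ kMin N := by
  have : 1 < kMin N := (lt_kMin_iff hN).2 (by simp only [tri]; omega)
  omega

lemma le_qMax_iff {N i q : ℕ} (hN : 2 ≤ N) : q ≤ qMax N i ↔ tri q + 1 < N + i := by
  rw [← lt_kMin_iff (by omega), qMax]
  have := two_le_kMin (N := N + i) (by omega)
  omega

lemma inBlock_iff {N i p : ℕ} :
    InBlock N i p ↔ tri (i - 1) < p ∧ (i < kMin N → p ≤ tri (i - 1) + (i + 1)) := by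
  rw [InBlock, tri_pred]

lemma inPair_iff {N i q p : ℕ} (hN : 2 ≤ N) :
    InPair N i q p ↔ i + 2 ≤ kMin N ∧ i + 2 ≤ q ∧ tri q + 1 < N + i ∧
      (p + i = tri q + 1 ∨ p + i = tri q + 2) := by
  rw [InPair, le_qMax_iff hN]
  rfl

lemma altPauli_ne_I (n : ℕ) : altPauli n ≠ .I := by
  unfold altPauli
  split_ifs <;> simp

lemma altPauli_eq_iff {m n : ℕ} : altPauli m = altPauli n ↔ m % 2 = n % 2 := by
  unfold altPauli
  by_cases hm : m % 2 = 1 <;> by_cases hn : n % 2 = 1 <;> simp [Nat.odd_iff, hm, hn]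
  all_goals omega

lemma tri_trichotomy (a b : ℕ) :
    (a < b ∧ tri a + a ≤ tri b) ∨ (a = b ∧ tri a = tri b) ∨ (b < a ∧ tri b + b ≤ tri a) := by
  rcases lt_trichotomy a b with h | rfl | h
  · exact .inl ⟨h, tri_add_le h⟩
  · exact .inr (.inl ⟨rfl, rfl⟩)
  · exact .inr (.inr ⟨h, tri_add_le h⟩)

lemma InPair.unique {N i q q' p : ℕ} (hN : 2 ≤ N) (h : InPair N i q p) (h' : InPair N i q' p) :
    q = q' := by
  rw [inPair_iff hN] at h h'
  have := tri_trichotomy q q'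
  omega

/-- The letters of a generator: `P_i` in its initial block, `P_{q+1}` in its `q`-th pair, and no
letter elsewhere. -/
lemma maxGen_succ_cases {N : ℕ} (hN : 2 ≤ N) (i : ℕ) (p : Fin N) :
    ((tri i < p + 1 ∧ (i + 1 < kMin N → p + 1 ≤ tri i + (i + 2))) ∧
      maxGen N (i + 1) p = altPauli (i + 1)) ∨
    (¬ (tri i < p + 1 ∧ (i + 1 < kMin N → p + 1 ≤ tri i + (i + 2))) ∧
      ∃ q, (i + 3 ≤ kMin N ∧ i + 3 ≤ q ∧ tri q < N + i ∧
        (p + 1 + i = tri q ∨ p + i = tri q)) ∧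
      maxGen N (i + 1) p = altPauli (q + 1)) ∨
    (¬ (tri i < p + 1 ∧ (i + 1 < kMin N → p + 1 ≤ tri i + (i + 2))) ∧
      (∀ q, ¬ (i + 3 ≤ kMin N ∧ i + 3 ≤ q ∧ tri q < N + i ∧
        (p + 1 + i = tri q ∨ p + i = tri q))) ∧
      maxGen N (i + 1) p = .I) := by
  have hblock : (tri i < p + 1 ∧ (i + 1 < kMin N → p + 1 ≤ tri i + (i + 2))) ↔
      InBlock N (i + 1) (p + 1) :=
    (inBlock_iff (N := N) (i := i + 1) (p := p + 1)).symm
  have hpair : ∀ q, (i + 3 ≤ kMin N ∧ i + 3 ≤ q ∧ tri q < N + i ∧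
      (p + 1 + i = tri q ∨ p + i = tri q)) ↔ InPair N (i + 1) q (p + 1) := fun q => by
    rw [inPair_iff hN]
    omega
  simp only [hblock, hpair]
  by_cases hb : InBlock N (i + 1) (p + 1)
  · exact .inl ⟨hb, by simp [maxGen, hb]⟩
  by_cases hq : ∃ q, InPair N (i + 1) q (p + 1)
  · obtain ⟨q, hq⟩ := hq
    refine .inr (.inl ⟨hb, q, hq, ?_⟩)
    have huniq : ∀ R : ℕ → Prop, (∃ q', InPair N (i + 1) q' (p + 1) ∧ R q') ↔ R q := fun R =>
      ⟨fun ⟨q', h1, h2⟩ => hq.unique hN h1 ▸ h2, fun h => ⟨q, hq, h⟩⟩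
    have h1 := huniq fun q => Odd (q + 1)
    have h2 := huniq fun q => Even (q + 1)
    simp only [maxGen, hb, if_false, h1, h2, altPauli]
    by_cases ho : Odd (q + 1)
    · simp [ho]
    · simp [ho, Nat.not_odd_iff_even.1 ho]
  · push Not at hq
    exact .inr (.inr ⟨hb, hq, by simp [maxGen, hb, hq]⟩)

/-- One of the letters is `X` and the other one is `Z`. -/
def Clash (a b : Pauli) : Prop := a ≠ .I ∧ b ≠ .I ∧ a ≠ b

/-- The generators `G_i` and `G_j` with `i < j` carry different letters exactly at two
neighbouring sites (or nowhere, if these sites lie beyond the last one). -/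
lemma clash_maxGen_iff {N i j : ℕ} (hN : 2 ≤ N) (hi : 1 ≤ i) (hij : i < j) (hj : j ≤ kMin N)
    (p : Fin N) :
    Clash (maxGen N i p) (maxGen N j p) ↔
      tri j + 2 ≤ N + i ∧ (p + 1 + i = tri j + 1 ∨ p + 1 + i = tri j + 2) := by
  have hp := p.isLt
  have hik : tri i + 1 < N := (lt_kMin_iff hN).1 (by omega)
  obtain ⟨i, rfl⟩ := Nat.exists_eq_add_of_le' hi
  obtain ⟨j, rfl⟩ := Nat.exists_eq_add_of_le' (hi.trans hij.le)
  have h1 : tri (i + 1) = tri i + i := tri_succ i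
  have h2 : tri (i + 2) = tri (i + 1) + (i + 1) := tri_succ (i + 1)
  have h3 : tri (i + 3) = tri (i + 2) + (i + 2) := tri_succ (i + 2)
  have h4 : tri (j + 1) = tri j + j := tri_succ j
  have h5 : tri (j + 2) = tri (j + 1) + (j + 1) := tri_succ (j + 1)
  -- the last block is no longer than the others
  have hlast : j + 1 < kMin N ∨ N ≤ tri (j + 1) + 1 := by
    rw [lt_kMin_iff hN]
    omega
  have t1 := tri_trichotomy j (i + 1)
  have t2 := tri_trichotomy j (i + 2)
  have n1 := altPauli_ne_I
  rcases maxGen_succ_cases hN i p with ⟨hb, e⟩ | ⟨hb, q, hq, e⟩ | ⟨hb, hq, e⟩ <;>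
  rcases maxGen_succ_cases hN j p with ⟨hb', e'⟩ | ⟨hb', q', hq', e'⟩ | ⟨hb', hq', e'⟩ <;>
  rw [e, e'] <;>
  simp only [Clash, ne_eq, altPauli_eq_iff, n1, not_true_eq_false, not_false_eq_true, true_and,
    false_and, and_false, false_iff]
  · omega
  · have := tri_trichotomy q' (j + 2)
    omega
  · omega
  · have := tri_trichotomy q j
    have := tri_trichotomy q (j + 1)
    have := tri_trichotomy q (j + 2)
    omega
  · have := tri_trichotomy q q'
    have := tri_trichotomy q (j + 1)
    have := tri_trichotomy q' (j + 2)
    omega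
  · omega
  · specialize hq (j + 1)
    omega
  · specialize hq (j + 1)
    omega
  · specialize hq (j + 1)
    omega

/-- Any two neighbouring sites are the sites at which some two generators carry different
letters. -/
lemma exists_clash_iff {N s : ℕ} (hs : s + 1 < N) :
    ∃ i ∈ Finset.Icc 1 (kMin N), ∃ j ∈ Finset.Icc 1 (kMin N), ∀ p : Fin N,
      Clash (maxGen N i p) (maxGen N j p) ↔ (p : ℕ) = s ∨ (p : ℕ) = s + 1 := by
  have hN : 2 ≤ N := by omega
  -- `j` is the number with `j (j - 1) / 2 ≤ s < j (j + 1) / 2`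
  have hex : ∃ j, s < tri (j + 1) := by
    refine ⟨s + 1, ?_⟩
    rw [tri_succ]
    omega
  classical
  obtain ⟨j, hj, hmin⟩ : ∃ j, s < tri (j + 1) ∧ tri j ≤ s := by
    refine ⟨Nat.find hex, Nat.find_spec hex, ?_⟩
    by_contra! h
    rcases Nat.eq_zero_or_pos (Nat.find hex) with h0 | h0
    · rw [h0] at h
      simp [tri] at h
    · exact Nat.find_min hex (m := Nat.find hex - 1) (by omega) (by rwa [Nat.sub_add_cancel h0])
  have h1 := tri_succ j
  have hk : j < kMin N := (lt_kMin_iff hN).2 (by omega)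
  refine ⟨tri (j + 1) - s, Finset.mem_Icc.2 ⟨by omega, by omega⟩, j + 1,
    Finset.mem_Icc.2 ⟨by omega, by omega⟩, fun p => ?_⟩
  rw [clash_maxGen_iff hN (by omega) (by omega) (by omega : j + 1 ≤ kMin N)]
  omega

lemma maxGen_zero_eq_I_iff {N i : ℕ} (hN : 2 ≤ N) (hi : 1 ≤ i) (p : Fin N) (hp : p.val = 0) :
    maxGen N i p = .I ↔ 3 ≤ i := by
  obtain ⟨i, rfl⟩ := Nat.exists_eq_add_of_le' hi
  have h0 : tri 1 = 0 := rfl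
  have h1 : tri 0 = 0 := rfl
  have t := tri_trichotomy 1 i
  rcases maxGen_succ_cases hN i p with ⟨hb, e⟩ | ⟨hb, q, hq, e⟩ | ⟨hb, hq, e⟩ <;>
  rw [e] <;>
  simp only [altPauli_ne_I, false_iff, true_iff]
  · omega
  · have := tri_trichotomy q (i + 2)
    have h2 : tri (i + 2) = tri (i + 1) + (i + 1) := tri_succ (i + 1)
    have h3 : tri (i + 1) = tri i + i := tri_succ i
    omega
  · by_contra hlt
    obtain rfl | rfl : i = 0 ∨ i = 1 := by omega
    all_goals omega

lemma maxGen_one_zero {N : ℕ} (p : Fin N) (hp : p.val = 0) : maxGen N 1 p = .X := by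
  have hb : InBlock N 1 1 := inBlock_iff.2 ⟨by simp [tri], by simp [tri]⟩
  simp [maxGen, hp, hb, altPauli]

lemma maxGen_two_zero {N : ℕ} (p : Fin N) (hp : p.val = 0) : maxGen N 2 p = .Z := by
  have hb : InBlock N 2 1 := inBlock_iff.2 ⟨by simp [tri], by simp [tri]⟩
  have : ¬ Odd 2 := by decide
  simp [maxGen, hp, hb, altPauli, this]

/-- The first site of the initial block of `G_i` carries the letter `P_i` in `G_i`, and no letter
or the letter `P_{i+1}` in the later generators. -/
lemma exists_site_not_clash_later {N i : ℕ} (hN : 2 ≤ N) (hi : 1 ≤ i) (hk : i ≤ kMin N) :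
    ∃ p : Fin N, Clash (altPauli (i + 1)) (maxGen N i p) ∧
      ∀ j, i < j → j ≤ kMin N → ¬ Clash (altPauli (i + 1)) (maxGen N j p) := by
  obtain ⟨i, rfl⟩ := Nat.exists_eq_add_of_le' hi
  have hik : tri i + 1 < N := (lt_kMin_iff hN).1 (by omega)
  obtain ⟨p, hp⟩ : ∃ p : Fin N, (p : ℕ) = tri i := ⟨⟨tri i, by omega⟩, rfl⟩
  refine ⟨p, ?_, fun j hij hj => ?_⟩
  · rcases maxGen_succ_cases hN i p with ⟨hb, e⟩ | ⟨hb, -⟩ | ⟨hb, -⟩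
    · rw [e]
      simp only [Clash, altPauli_ne_I, ne_eq, not_false_eq_true, altPauli_eq_iff, true_and]
      omega
    all_goals omega
  · obtain ⟨j, rfl⟩ := Nat.exists_eq_add_of_le' (hi.trans hij.le)
    have t1 := tri_trichotomy i j
    have t2 := tri_trichotomy (i + 1) j
    have h1 : tri (i + 1) = tri i + i := tri_succ i
    rcases maxGen_succ_cases hN j p with ⟨hb, e⟩ | ⟨hb, q, hq, e⟩ | ⟨hb, hq, e⟩ <;>
    rw [e] <;>
    simp only [Clash, ne_eq, altPauli_eq_iff, altPauli_ne_I, not_true_eq_false, not_false_eq_true,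
      true_and, false_and, and_false]
    · omega
    · have h2 : tri (j + 1) = tri j + j := tri_succ j
      have h3 : tri (j + 2) = tri (j + 1) + (j + 1) := tri_succ (j + 1)
      have := tri_trichotomy q (j + 2)
      omega

end Combinatorics

/-! ### The stabilizer subspace is not zero -/

section Stabilizer

lemma toMatrix_mul_self (a : Pauli) : a.toMatrix * a.toMatrix = 1 := by
  ext i j
  cases a <;> fin_cases i <;> fin_cases j <;> simp [Pauli.toMatrix, Matrix.mul_apply]

lemma toMatrix_conjTranspose (a : Pauli) : (a.toMatrix)ᴴ = a.toMatrix := by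
  ext i j
  cases a <;> fin_cases i <;> fin_cases j <;> simp [Pauli.toMatrix, Matrix.conjTranspose_apply]

open Classical in
lemma toMatrix_mul_comm (a b : Pauli) :
    a.toMatrix * b.toMatrix = (if Clash a b then -1 else 1 : ℂ) • (b.toMatrix * a.toMatrix) := by
  ext i j
  cases a <;> cases b <;> fin_cases i <;> fin_cases j <;>
    simp [Pauli.toMatrix, Clash, Matrix.mul_apply]

lemma tensor_update_smul {N : ℕ} {a b : Fin N → Type} (A : ∀ i, Matrix (a i) (b i) ℂ) (p : Fin N)
    (r : ℂ) (M : Matrix (a p) (b p) ℂ) :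
    tensor (Function.update A p (r • M)) = r • tensor (Function.update A p M) := by
  ext x y
  simp only [tensor_update, Matrix.smul_apply, smul_eq_mul, mul_assoc]

open Classical in
lemma prod_sign_maxGen {N i j : ℕ} (hN : 2 ≤ N) (hi : 1 ≤ i) (hij : i < j) (hj : j ≤ kMin N) :
    ∏ p : Fin N, (if Clash (maxGen N i p) (maxGen N j p) then -1 else 1 : ℂ) = 1 := by
  simp only [clash_maxGen_iff hN hi hij hj]
  have hT : i ≤ tri j := by
    have h1 := tri_add_le hij
    have h2 := tri_add_le (Nat.lt_of_lt_of_le Nat.zero_lt_one hi)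
    rcases Nat.lt_or_ge i 2 with h | h
    · have h3 := tri_mono (show 2 ≤ j by omega)
      have h4 : tri 2 = 1 := rfl
      omega
    · omega
  by_cases hs : tri j + 2 ≤ N + i
  · rw [Finset.prod_eq_mul (⟨tri j - i, by omega⟩ : Fin N) ⟨tri j - i + 1, by omega⟩]
    · rw [if_pos ⟨hs, by simp only; omega⟩, if_pos ⟨hs, by simp only; omega⟩]
      norm_num
    · simp
    · intro c _ hc
      rw [if_neg]
      rintro ⟨-, h⟩
      simp only [ne_eq, Fin.ext_iff] at hc
      omega
    · simp
    · simp
  · simp [hs]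

/-- The generator `G_i`, as an operator on `N` qubits. -/
noncomputable def genOp (N i : ℕ) : Matrix (Fin N → Fin 2) (Fin N → Fin 2) ℂ :=
  tensor fun p => (maxGen N i p).toMatrix

lemma genOp_mul_self (N i : ℕ) : genOp N i * genOp N i = 1 := by
  rw [genOp, tensor_mul]
  simp only [toMatrix_mul_self]
  exact tensor_one

lemma genOp_comm {N i j : ℕ} (hN : 2 ≤ N) (hi : 1 ≤ i) (hij : i < j) (hj : j ≤ kMin N) :
    genOp N i * genOp N j = genOp N j * genOp N i := by
  classical
  rw [genOp, genOp, tensor_mul, tensor_mul]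
  simp only [fun p => toMatrix_mul_comm (maxGen N i p) (maxGen N j p)]
  rw [tensor_smul, prod_sign_maxGen hN hi hij hj, one_smul]

open Classical in
lemma siteOp_mul_genOp {N : ℕ} (i : ℕ) (p : Fin N) (a : Pauli) :
    siteOp (a := fun _ => Fin 2) p a.toMatrix * genOp N i =
      (if Clash a (maxGen N i p) then -1 else 1 : ℂ) •
        (genOp N i * siteOp (a := fun _ => Fin 2) p a.toMatrix) := by
  rw [genOp, siteOp_mul_tensor, tensor_mul_siteOp, toMatrix_mul_comm, tensor_update_smul]

/-- The generators have a common fixed vector. They commute, and for each `i` a one-site operator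
anticommutes with `G_i` and commutes with the later generators: if `G_i` acts as `-1` on a common
fixed vector of the later generators, the image of this vector under the one-site operator is fixed
by `G_i` as well. -/
lemma exists_fixed_vector {N : ℕ} (hN : 2 ≤ N) :
    ∃ v : (Fin N → Fin 2) → ℂ, v ≠ 0 ∧ ∀ i ∈ Finset.Icc 1 (kMin N), (genOp N i).mulVec v = v := by
  have key : ∀ m ≤ kMin N, ∃ v : (Fin N → Fin 2) → ℂ, v ≠ 0 ∧
      ∀ i, kMin N - m < i → i ≤ kMin N → (genOp N i).mulVec v = v := by
    intro m
    induction m with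
    | zero =>
      intro _
      exact ⟨1, one_ne_zero, fun i h1 h2 => by omega⟩
    | succ m ih =>
      intro hm
      obtain ⟨v, hv, hfix⟩ := ih (by omega)
      obtain ⟨i, hi⟩ : ∃ i, i + m = kMin N := ⟨kMin N - m, by omega⟩
      by_cases hsum : v + (genOp N i).mulVec v = 0
      · obtain ⟨p, hp, hlater⟩ := exists_site_not_clash_later hN (i := i) (by omega) (by omega)
        set Q := siteOp (a := fun _ => Fin 2) p (altPauli (i + 1)).toMatrix with hQ
        have hGv : (genOp N i).mulVec v = -v := by
          rw [eq_neg_iff_add_eq_zero, add_comm, hsum]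
        have hQQ : Q * Q = 1 := by
          rw [hQ, siteOp_mul, toMatrix_mul_self]
          exact siteOp_one p
        refine ⟨Q.mulVec v, fun h0 => hv ?_, fun j hj1 hj2 => ?_⟩
        · rw [← Matrix.one_mulVec v, ← hQQ, ← Matrix.mulVec_mulVec, h0, Matrix.mulVec_zero]
        · classical
          have hcomm := siteOp_mul_genOp j p (altPauli (i + 1))
          rw [← hQ] at hcomm
          rcases Nat.eq_or_lt_of_le (show i ≤ j by omega) with rfl | hlt
          · rw [if_pos hp, neg_one_smul, eq_neg_iff_add_eq_zero] at hcomm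
            have h' := congrArg (fun M => M.mulVec v) hcomm
            simp only [Matrix.add_mulVec, ← Matrix.mulVec_mulVec, hGv, Matrix.zero_mulVec,
              Matrix.mulVec_neg] at h'
            exact (neg_add_eq_zero.1 h').symm
          · rw [if_neg (hlater j hlt hj2), one_smul] at hcomm
            rw [Matrix.mulVec_mulVec, ← hcomm, ← Matrix.mulVec_mulVec, hfix j (by omega) hj2]
      · refine ⟨_, hsum, fun j hj1 hj2 => ?_⟩
        rw [Matrix.mulVec_add]
        rcases Nat.eq_or_lt_of_le (show i ≤ j by omega) with rfl | hlt
        · rw [Matrix.mulVec_mulVec, genOp_mul_self, Matrix.one_mulVec, add_comm]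
        · rw [Matrix.mulVec_mulVec, ← genOp_comm hN (by omega) hlt hj2, ← Matrix.mulVec_mulVec,
            hfix j (by omega) hj2]
  obtain ⟨v, hv, h⟩ := key (kMin N) le_rfl
  refine ⟨v, hv, fun i hi => ?_⟩
  rw [Finset.mem_Icc] at hi
  exact h i (by omega) hi.2

end Stabilizer

/-! ### The Bell expression as an expectation value -/

section BellOperator

variable {N : ℕ} {d : Fin N → ℕ}

/-- The operators of a party that stand for the letters in the sum of squares: `(A_0 + A_1) / √2`
and `(A_0 - A_1) / √2` for the first party, `A_0` and `A_1` for the others. -/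
noncomputable def letterOp (A : ∀ i, Fin 2 → Matrix (Fin (d i)) (Fin (d i)) ℂ) (p : Fin N) :
    Pauli → Matrix (Fin (d p)) (Fin (d p)) ℂ
  | .I => 1
  | .X => if p.val = 0 then ((√2 : ℝ) : ℂ)⁻¹ • (A p 0 + A p 1) else A p 0
  | .Z => if p.val = 0 then ((√2 : ℝ) : ℂ)⁻¹ • (A p 0 - A p 1) else A p 1

/-- The ratio of the operator substituted for a letter in the Bell expression to `letterOp`. -/
noncomputable def letterWeight (p : Fin N) (L : Pauli) : ℝ :=
  open Classical in if p.val = 0 ∧ L ≠ .I then √2 else 1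

lemma sum_siteCoeff_smul (A : ∀ i, Fin 2 → Matrix (Fin (d i)) (Fin (d i)) ℂ) (p : Fin N)
    (L : Pauli) :
    ∑ s, (siteCoeff p L s : ℂ) • measured (A p) s = (letterWeight p L : ℂ) • letterOp A p L := by
  have h2 : ((√2 : ℝ) : ℂ) ≠ 0 := by simp
  rw [Fintype.sum_option, Fin.sum_univ_two]
  cases L <;> by_cases hp : p.val = 0 <;>
    simp [siteCoeff, letterWeight, letterOp, measured, hp, smul_smul, h2, sub_eq_add_neg]

lemma bellTerm_correlations (ρ : Matrix (∀ i, Fin (d i)) (∀ i, Fin (d i)) ℂ)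
    (A : ∀ i, Fin 2 → Matrix (Fin (d i)) (Fin (d i)) ℂ) (g : Fin N → Pauli) :
    bellTerm g (correlations ρ A) =
      (∏ p, letterWeight p (g p)) * ((tensor fun p => letterOp A p (g p)) * ρ).trace.re := by
  have h1 : (∏ p, ((letterWeight p (g p) : ℝ) : ℂ)) • (tensor fun p => letterOp A p (g p)) =
      ∑ s : Setting N, (∏ p, ((siteCoeff p (g p) (s p) : ℝ) : ℂ)) •
        tensor fun p => measured (A p) (s p) := by
    rw [← tensor_smul]
    simp only [← sum_siteCoeff_smul, ← tensor_smul]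
    exact tensor_sum _
  have h2 := congrArg (fun M => (M * ρ).trace.re) h1
  simp only [Matrix.sum_mul, Matrix.trace_sum, Matrix.smul_mul, Matrix.trace_smul, Complex.re_sum,
    smul_eq_mul, ← Complex.ofReal_prod, Complex.re_ofReal_mul] at h2
  rw [h2]
  rfl

/-- The weight of the `i`-th term of the Bell expression: `√2` for the two generators that act on
the first party, and `1` for the others. -/
noncomputable def genWeight (i : ℕ) : ℝ := if i ≤ 2 then √2 else 1

lemma genWeight_pos (i : ℕ) : 0 < genWeight i := by
  unfold genWeight
  split_ifs <;> positivity

lemma prod_letterWeight {i : ℕ} (hN : 2 ≤ N) (hi : 1 ≤ i) :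
    ∏ p : Fin N, letterWeight p (maxGen N i p) = genWeight i := by
  rw [Finset.prod_eq_single ⟨0, by omega⟩]
  · have := maxGen_zero_eq_I_iff hN hi ⟨0, by omega⟩ rfl
    simp only [letterWeight, genWeight, ne_eq, this, true_and]
    congr 1
    exact propext (by omega)
  · intro p _ hp
    rw [letterWeight, if_neg]
    exact fun h => hp (Fin.ext h.1)
  · simp

lemma bellExpr_correlations (hN : 2 ≤ N) (ρ : Matrix (∀ i, Fin (d i)) (∀ i, Fin (d i)) ℂ)
    (A : ∀ i, Fin 2 → Matrix (Fin (d i)) (Fin (d i)) ℂ) :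
    bellExpr N (correlations ρ A) = ∑ i ∈ Finset.Icc 1 (kMin N),
      genWeight i * ((tensor fun p => letterOp A p (maxGen N i p)) * ρ).trace.re := by
  refine Finset.sum_congr rfl fun i hi => ?_
  rw [bellTerm_correlations, prod_letterWeight hN (Finset.mem_Icc.1 hi).1]

/-- The observables of the qubit strategy, for which the letters stand for the Pauli matrices. -/
noncomputable def qubitObs (p : Fin N) (x : Fin 2) : Matrix (Fin 2) (Fin 2) ℂ :=
  if p.val = 0 then
    ((√2 : ℝ) : ℂ)⁻¹ • (Pauli.X.toMatrix + (if x = 0 then 1 else -1 : ℂ) • Pauli.Z.toMatrix)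
  else if x = 0 then Pauli.X.toMatrix else Pauli.Z.toMatrix

lemma sqrt_two_inv_mul_self : ((√2 : ℝ) : ℂ)⁻¹ * ((√2 : ℝ) : ℂ)⁻¹ = 1 / 2 := by
  rw [← mul_inv, ← Complex.ofReal_mul, Real.mul_self_sqrt zero_le_two]
  norm_num

lemma qubitObs_isDichotomic (p : Fin N) (x : Fin 2) : IsDichotomic (qubitObs p x) := by
  have hX := toMatrix_conjTranspose .X
  have hZ := toMatrix_conjTranspose .Z
  unfold qubitObs
  split_ifs with h1 h2 h2
  · refine ⟨?_, ?_⟩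
    · rw [Matrix.IsHermitian]
      simp [Matrix.conjTranspose_add, hX, hZ]
    · rw [Matrix.smul_mul, Matrix.mul_smul, smul_smul, sqrt_two_inv_mul_self]
      ext i j
      fin_cases i <;> fin_cases j <;> simp [Pauli.toMatrix] <;> norm_num
  · refine ⟨?_, ?_⟩
    · rw [Matrix.IsHermitian]
      simp [Matrix.conjTranspose_add, hX, hZ]
    · rw [Matrix.smul_mul, Matrix.mul_smul, smul_smul, sqrt_two_inv_mul_self]
      ext i j
      fin_cases i <;> fin_cases j <;> simp [Pauli.toMatrix] <;> norm_num
  · exact ⟨hX, toMatrix_mul_self .X⟩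
  · exact ⟨hZ, toMatrix_mul_self .Z⟩

lemma letterOp_qubitObs (p : Fin N) (L : Pauli) :
    letterOp (d := fun _ => 2) qubitObs p L = L.toMatrix := by
  have h := sqrt_two_inv_mul_self
  cases L
  · rfl
  · by_cases hp : p.val = 0
    · simp only [letterOp, qubitObs, hp, if_true, ← smul_add, smul_smul, h]
      ext i j
      fin_cases i <;> fin_cases j <;> simp [Pauli.toMatrix]
      all_goals norm_num
    · simp [letterOp, qubitObs, hp]
  · by_cases hp : p.val = 0
    · simp only [letterOp, qubitObs, hp, if_true, ← smul_sub, smul_smul, h]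
      ext i j
      fin_cases i <;> fin_cases j <;> simp [Pauli.toMatrix]
      all_goals norm_num
    · simp [letterOp, qubitObs, hp]

/-- A state of the stabilizer subspace gives every term of the Bell expression its weight. -/
lemma exists_quantum_bellExpr_eq (hN : 2 ≤ N) :
    ∃ P ∈ quantumSet N, bellExpr N P = ∑ i ∈ Finset.Icc 1 (kMin N), genWeight i := by
  obtain ⟨v, hv, hfix⟩ := exists_fixed_vector hN
  let ρ₀ : Matrix (Fin N → Fin 2) (Fin N → Fin 2) ℂ := Matrix.vecMulVec v (star v)
  have hpsd : ρ₀.PosSemidef := Matrix.posSemidef_vecMulVec_self_star v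
  have htr : ρ₀.trace ≠ 0 := by
    rw [Matrix.trace_vecMulVec]
    simpa using hv
  have hpos : 0 ≤ ρ₀.trace := hpsd.trace_nonneg
  let ρ := ρ₀.trace⁻¹ • ρ₀
  have hρtr : ρ.trace = 1 := by
    rw [Matrix.trace_smul, smul_eq_mul, inv_mul_cancel₀ htr]
  have hρ : IsDensity ρ := ⟨hpsd.smul (inv_nonneg.2 hpos), hρtr⟩
  refine ⟨correlations (d := fun _ => 2) ρ qubitObs,
    ⟨fun _ => 2, ρ, qubitObs, hρ, qubitObs_isDichotomic, rfl⟩, ?_⟩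
  rw [bellExpr_correlations hN]
  refine Finset.sum_congr rfl fun i hi => ?_
  have h1 : genOp N i * ρ = ρ := by
    rw [Matrix.mul_smul, Matrix.mul_vecMulVec, hfix i hi]
  have h2 : ((tensor fun p => letterOp (d := fun _ => 2) qubitObs p (maxGen N i p)) * ρ) = ρ := by
    simp only [letterOp_qubitObs]
    exact h1
  rw [h2, hρtr]
  simp

end BellOperator

/-! ### Maximal violation and the stabilizing conditions -/

section SumOfSquares

variable {N : ℕ} {d : Fin N → ℕ} {A : ∀ i, Fin 2 → Matrix (Fin (d i)) (Fin (d i)) ℂ}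

lemma letterOp_conjTranspose (hA : ∀ i x, IsDichotomic (A i x)) (p : Fin N) (L : Pauli) :
    (letterOp A p L)ᴴ = letterOp A p L := by
  have h : ∀ x, (A p x)ᴴ = A p x := fun x => (hA p x).1
  cases L
  · simp [letterOp]
  · simp only [letterOp]
    split_ifs <;> simp [Matrix.conjTranspose_add, h]
  · simp only [letterOp]
    split_ifs <;> simp [Matrix.conjTranspose_sub, h]

lemma letterOp_mul_self (hA : ∀ i x, IsDichotomic (A i x)) {p : Fin N} {L : Pauli}
    (h : p.val ≠ 0 ∨ L = .I) : letterOp A p L * letterOp A p L = 1 := by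
  have h2 : ∀ x, A p x * A p x = 1 := fun x => (hA p x).2
  by_cases hp : p.val = 0
  · obtain rfl := h.resolve_left (not_not_intro hp)
    simp [letterOp]
  · cases L <;> simp [letterOp, hp, h2]

/-- The operators `(A_0 + A_1) / √2` and `(A_0 - A_1) / √2` need not be involutions, but their
squares add up to `2`. -/
lemma letterOp_sq_add_sq (hA : ∀ i x, IsDichotomic (A i x)) {p : Fin N} (hp : p.val = 0) :
    letterOp A p .X * letterOp A p .X + letterOp A p .Z * letterOp A p .Z = 1 + 1 := by
  have h2 : ∀ x, A p x * A p x = 1 := fun x => (hA p x).2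
  simp only [letterOp, hp, if_true, Matrix.smul_mul, Matrix.mul_smul, smul_smul,
    sqrt_two_inv_mul_self]
  rw [← smul_add]
  simp only [Matrix.add_mul, Matrix.mul_add, Matrix.sub_mul, Matrix.mul_sub, h2]
  have : (1 + A p 1 * A p 0 + (A p 0 * A p 1 + 1) + (1 - A p 1 * A p 0 - (A p 0 * A p 1 - 1))) =
      (2 : ℂ) • ((1 : Matrix (Fin (d p)) (Fin (d p)) ℂ) + 1) := by
    rw [two_smul]
    abel
  rw [this, smul_smul]
  norm_num

lemma letterOp_anticommute (hA : ∀ i x, IsDichotomic (A i x)) {p : Fin N} (hp : p.val = 0) :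
    letterOp A p .X * letterOp A p .Z = -(letterOp A p .Z * letterOp A p .X) := by
  have h2 : ∀ x, A p x * A p x = 1 := fun x => (hA p x).2
  simp only [letterOp, hp, if_true, Matrix.smul_mul, Matrix.mul_smul]
  rw [← smul_neg, ← smul_neg]
  congr 2
  simp only [Matrix.add_mul, Matrix.mul_add, Matrix.sub_mul, Matrix.mul_sub, h2]
  abel

/-- The operator of the `i`-th generator, with the observables of the parties substituted. -/
noncomputable def genObs (A : ∀ i, Fin 2 → Matrix (Fin (d i)) (Fin (d i)) ℂ) (i : ℕ) :
    Matrix (∀ i, Fin (d i)) (∀ i, Fin (d i)) ℂ :=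
  tensor fun p => letterOp A p (maxGen N i p)

lemma genObs_conjTranspose (hA : ∀ i x, IsDichotomic (A i x)) (i : ℕ) :
    (genObs A i)ᴴ = genObs A i := by
  rw [genObs, tensor_conjTranspose]
  simp only [letterOp_conjTranspose hA]

lemma genObs_mul_self (hA : ∀ i x, IsDichotomic (A i x)) {p : Fin N} (hp : p.val = 0) (i : ℕ) :
    genObs A i * genObs A i = siteOp (a := fun i => Fin (d i)) p
      (letterOp A p (maxGen N i p) * letterOp A p (maxGen N i p)) := by
  rw [genObs, tensor_mul, siteOp]
  congr 1
  funext t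
  rcases eq_or_ne t p with rfl | ht
  · simp
  · rw [Function.update_of_ne ht, letterOp_mul_self hA]
    exact .inl fun h0 => ht (Fin.ext (h0.trans hp.symm))

variable {E : Type} [Fintype E] {Φ : Matrix (∀ i, Fin (d i)) E ℂ}

/-- The squared distances `‖G_i Φ - Φ‖²`, weighted as in the Bell expression, add up to twice the
deficit of the Bell expression. -/
lemma sum_weighted_sq (hN : 2 ≤ N) (hA : ∀ i x, IsDichotomic (A i x))
    (hΦ : (Φ * Φᴴ).trace = 1) :
    ∑ i ∈ Finset.Icc 1 (kMin N),
      genWeight i * ((genObs A i * Φ - Φ)ᴴ * (genObs A i * Φ - Φ)).trace.re =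
    2 * ∑ i ∈ Finset.Icc 1 (kMin N), genWeight i * (1 - (genObs A i * (Φ * Φᴴ)).trace.re) := by
  obtain ⟨p, hp⟩ : ∃ p : Fin N, p.val = 0 := ⟨⟨0, by omega⟩, rfl⟩
  have hexp : ∀ i, ((genObs A i * Φ - Φ)ᴴ * (genObs A i * Φ - Φ)).trace.re =
      ((genObs A i * genObs A i * (Φ * Φᴴ)).trace.re - 1) +
        2 * (1 - (genObs A i * (Φ * Φᴴ)).trace.re) := by
    intro i
    have e1 : ((genObs A i * Φ - Φ)ᴴ * (genObs A i * Φ - Φ)).trace =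
        (genObs A i * genObs A i * (Φ * Φᴴ)).trace - (genObs A i * (Φ * Φᴴ)).trace -
          ((genObs A i * (Φ * Φᴴ)).trace - 1) := by
      rw [Matrix.trace_mul_comm, Matrix.conjTranspose_sub, Matrix.conjTranspose_mul,
        genObs_conjTranspose hA, Matrix.sub_mul, Matrix.mul_sub, Matrix.mul_sub,
        Matrix.trace_sub, Matrix.trace_sub, Matrix.trace_sub, hΦ]
      congr 1
      · congr 1
        · rw [← Matrix.mul_assoc, Matrix.trace_mul_comm]
          simp only [Matrix.mul_assoc]
        · rw [Matrix.mul_assoc]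
      · congr 1
        rw [← Matrix.mul_assoc, Matrix.trace_mul_comm]
    rw [e1]
    simp only [Complex.sub_re, Complex.one_re]
    ring
  simp only [hexp, mul_add, Finset.sum_add_distrib]
  have hIcc : Finset.Icc 1 (kMin N) = insert 1 (insert 2 (Finset.Icc 3 (kMin N))) := by
    have := two_le_kMin hN
    ext i
    simp only [Finset.mem_insert, Finset.mem_Icc]
    omega
  have hzero : ∑ i ∈ Finset.Icc 1 (kMin N),
      genWeight i * ((genObs A i * genObs A i * (Φ * Φᴴ)).trace.re - 1) = 0 := by
    rw [hIcc, Finset.sum_insert (by simp), Finset.sum_insert (by simp), Finset.sum_eq_zero,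
      add_zero]
    · have hsum : (genObs A 1 * genObs A 1 * (Φ * Φᴴ)).trace.re +
          (genObs A 2 * genObs A 2 * (Φ * Φᴴ)).trace.re = 2 := by
        rw [genObs_mul_self hA hp, genObs_mul_self hA hp, maxGen_one_zero p hp,
          maxGen_two_zero p hp, ← Complex.add_re, ← Matrix.trace_add, ← Matrix.add_mul,
          ← siteOp_add, letterOp_sq_add_sq hA hp, siteOp_add, siteOp_one, Matrix.add_mul,
          Matrix.one_mul, Matrix.trace_add, hΦ]
        norm_num
      simp only [genWeight, le_refl, Nat.one_le_ofNat, if_true]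
      rw [← mul_add]
      have : (genObs A 1 * genObs A 1 * (Φ * Φᴴ)).trace.re - 1 +
          ((genObs A 2 * genObs A 2 * (Φ * Φᴴ)).trace.re - 1) = 0 := by linarith
      rw [this, mul_zero]
    · intro i hi
      have hi3 := (Finset.mem_Icc.1 hi).1
      rw [genObs_mul_self hA hp, (maxGen_zero_eq_I_iff hN (by omega) p hp).2 hi3,
        letterOp_mul_self hA (.inr rfl), siteOp_one, Matrix.one_mul, hΦ]
      simp
  rw [hzero, zero_add, Finset.mul_sum]
  exact Finset.sum_congr rfl fun i _ => by ring

/-- A state at which the Bell expression is maximal is fixed by all the generators. -/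
lemma genObs_mul_eq_self (hN : 2 ≤ N) (hA : ∀ i x, IsDichotomic (A i x))
    (hΦ : (Φ * Φᴴ).trace = 1)
    (hmax : ∑ i ∈ Finset.Icc 1 (kMin N), genWeight i ≤ bellExpr N (correlations (Φ * Φᴴ) A))
    {i : ℕ} (hi : i ∈ Finset.Icc 1 (kMin N)) : genObs A i * Φ = Φ := by
  have hnn : ∀ M : Matrix (∀ i, Fin (d i)) E ℂ, 0 ≤ (Mᴴ * M).trace :=
    fun M => (Matrix.posSemidef_conjTranspose_mul_self M).trace_nonneg
  have hterm : ∀ i ∈ Finset.Icc 1 (kMin N),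
      0 ≤ genWeight i * ((genObs A i * Φ - Φ)ᴴ * (genObs A i * Φ - Φ)).trace.re :=
    fun i _ => mul_nonneg (genWeight_pos i).le (Complex.le_def.1 (hnn _)).1
  have hle : ∑ i ∈ Finset.Icc 1 (kMin N),
      genWeight i * ((genObs A i * Φ - Φ)ᴴ * (genObs A i * Φ - Φ)).trace.re ≤ 0 := by
    rw [sum_weighted_sq hN hA hΦ]
    rw [bellExpr_correlations hN] at hmax
    simp only [mul_sub, mul_one, Finset.sum_sub_distrib, genObs]
    linarith
  have h0 := (Finset.sum_eq_zero_iff_of_nonneg hterm).1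
    (le_antisymm hle (Finset.sum_nonneg hterm)) i hi
  have h1 := (mul_eq_zero.1 h0).resolve_left (genWeight_pos i).ne'
  rw [← sub_eq_zero, ← Matrix.trace_conjTranspose_mul_self_eq_zero_iff]
  exact Complex.ext h1 (Complex.le_def.1 (hnn _)).2.symm

end SumOfSquares

/-! ### Restriction to the supports of the reduced states -/

section Support

variable {N : ℕ} {d : Fin N → ℕ} {A : ∀ i, Fin 2 → Matrix (Fin (d i)) (Fin (d i)) ℂ}
  {E : Type} {Φ : Matrix (∀ i, Fin (d i)) E ℂ}

lemma exists_maxGen_eq (hN : 2 ≤ N) (p : Fin N) {L : Pauli} (hL : L ≠ .I) :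
    ∃ i ∈ Finset.Icc 1 (kMin N), maxGen N i p = L := by
  obtain ⟨i, hi, j, hj, h⟩ : ∃ i ∈ Finset.Icc 1 (kMin N), ∃ j ∈ Finset.Icc 1 (kMin N),
      Clash (maxGen N i p) (maxGen N j p) := by
    by_cases hp : p.val + 1 < N
    · obtain ⟨i, hi, j, hj, h⟩ := exists_clash_iff hp
      exact ⟨i, hi, j, hj, (h p).2 (.inl rfl)⟩
    · obtain ⟨i, hi, j, hj, h⟩ := exists_clash_iff (N := N) (s := p.val - 1) (by omega)
      exact ⟨i, hi, j, hj, (h p).2 (.inr (by omega))⟩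
  have hcase : ∀ a b : Pauli, Clash a b → a = L ∨ b = L := by
    intro a b
    cases a <;> cases b <;> cases L <;> simp_all [Clash]
  rcases hcase _ _ h with h | h
  · exact ⟨i, hi, h⟩
  · exact ⟨j, hj, h⟩

lemma siteOp_letterOp_sq (hN : 2 ≤ N) (hA : ∀ i x, IsDichotomic (A i x))
    (hfix : ∀ i ∈ Finset.Icc 1 (kMin N), genObs A i * Φ = Φ) (p : Fin N) (L : Pauli) :
    siteOp (a := fun i => Fin (d i)) p (letterOp A p L * letterOp A p L) * Φ = Φ := by
  by_cases h : p.val ≠ 0 ∨ L = .I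
  · rw [letterOp_mul_self hA h, siteOp_one, Matrix.one_mul]
  · push Not at h
    obtain ⟨i, hi, rfl⟩ := exists_maxGen_eq hN p h.2
    rw [← genObs_mul_self hA h.1, Matrix.mul_assoc, hfix i hi, hfix i hi]

variable [Fintype E]

/-- On the state, the operator of one party acts as an operator of the other parties. Hence it
preserves the support of the reduced state. -/
lemma letterOp_preserves_support (hN : 2 ≤ N) (hA : ∀ i x, IsDichotomic (A i x))
    (hfix : ∀ i ∈ Finset.Icc 1 (kMin N), genObs A i * Φ = Φ) (p : Fin N) (L : Pauli)
    {Q : Matrix (Fin (d p)) (Fin (d p)) ℂ}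
    (hQ : Q * localState (Φ * Φᴴ) p = localState (Φ * Φᴴ) p) :
    Q * (letterOp A p L * localState (Φ * Φᴴ) p) = letterOp A p L * localState (Φ * Φᴴ) p := by
  by_cases hL : L = .I
  · simpa [hL, letterOp] using hQ
  obtain ⟨i, hi, hiL⟩ := exists_maxGen_eq hN p hL
  set S' := tensor (Function.update (fun p => letterOp A p (maxGen N i p)) p 1) with hS'
  have hcomm : ∀ M, siteOp (a := fun i => Fin (d i)) p M * S' = S' * siteOp p M := fun M =>
    siteOp_comm_tensor (a := fun i => Fin (d i)) p M _
  have h1 : siteOp (a := fun i => Fin (d i)) p (letterOp A p L) * Φ = S' * Φ := by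
    have h2 : siteOp (a := fun i => Fin (d i)) p (letterOp A p L) * S' * Φ = Φ := by
      have := hfix i hi
      rwa [genObs, tensor_eq_siteOp_mul (a := fun i => Fin (d i)) p, hiL] at this
    nth_rewrite 1 [← h2]
    rw [← Matrix.mul_assoc, ← Matrix.mul_assoc, siteOp_mul (a := fun i => Fin (d i)), hcomm,
      Matrix.mul_assoc, siteOp_letterOp_sq hN hA hfix]
  have h3 := (siteOp_mul_eq_self_iff Φ p Q).2 hQ
  have h4 : siteOp (a := fun i => Fin (d i)) p (Q * letterOp A p L - letterOp A p L) * Φ = 0 := by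
    rw [siteOp_sub (a := fun i => Fin (d i)), ← siteOp_mul (a := fun i => Fin (d i)),
      Matrix.sub_mul, Matrix.mul_assoc, h1, ← Matrix.mul_assoc, hcomm, Matrix.mul_assoc, h3,
      sub_self]
  rwa [siteOp_mul_eq_zero_iff, Matrix.sub_mul, sub_eq_zero, Matrix.mul_assoc] at h4

end Support

/-! ### Propagation of anticommutation along the sites -/

section Propagation

variable {N : ℕ} {a : Fin N → Type} [∀ i, DecidableEq (a i)] [∀ i, Fintype (a i)]

/-- If two products of involutions fix a common vector and differ, by anticommuting factors, at
the site `p`, and else only at the site `r`, then the factors at `r` anticommute as well. -/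
lemma anticommute_of_clash {E : Type} {Φ : Matrix (∀ i, a i) E ℂ}
    {O : ∀ i, Pauli → Matrix (a i) (a i) ℂ} (hI : ∀ i, O i .I = 1)
    (hsq : ∀ i L, O i L * O i L = 1) {g h : Fin N → Pauli}
    (hg : (tensor fun i => O i (g i)) * Φ = Φ) (hh : (tensor fun i => O i (h i)) * Φ = Φ)
    {p r : Fin N} (hpr : p ≠ r) (hclash : ∀ t, Clash (g t) (h t) ↔ t = p ∨ t = r)
    (hp : O p .X * O p .Z = -(O p .Z * O p .X))
    (hfaithful : ∀ M : Matrix (a r) (a r) ℂ, siteOp r M * Φ = 0 → M = 0) :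
    O r .X * O r .Z = -(O r .Z * O r .X) := by
  have hcase : ∀ x y : Pauli, Clash x y → (x = .X ∧ y = .Z) ∨ (x = .Z ∧ y = .X) := by
    intro x y
    cases x <;> cases y <;> simp [Clash]
  -- the square of the product of the two operators fixes the vector, and acts at `p` and `r` only
  set f : ∀ i, Matrix (a i) (a i) ℂ := fun i => O i (g i) * O i (h i) with hf
  have hfΦ : tensor f * Φ = Φ := by
    rw [hf, ← tensor_mul, Matrix.mul_assoc, hh, hg]
  have hfp : f p * f p = -1 := by
    have h1 : O p (g p) * O p (h p) = -(O p (h p) * O p (g p)) := by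
      rcases hcase _ _ ((hclash p).2 (.inl rfl)) with ⟨e1, e2⟩ | ⟨e1, e2⟩
      · rw [e1, e2, hp]
      · rw [e1, e2, hp, neg_neg]
    calc f p * f p = O p (g p) * O p (h p) * -(O p (h p) * O p (g p)) := by rw [← h1]
      _ = -(O p (g p) * (O p (h p) * O p (h p)) * O p (g p)) := by
          simp only [Matrix.mul_neg, Matrix.mul_assoc]
      _ = -1 := by rw [hsq, Matrix.mul_one, hsq]
  have hft : ∀ t, t ≠ p → t ≠ r → f t * f t = 1 := by
    intro t h1 h2
    have hn : ¬ Clash (g t) (h t) := by simp [hclash, h1, h2]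
    have h3 : g t = .I ∨ h t = .I ∨ g t = h t := by
      simp only [Clash] at hn
      tauto
    rcases h3 with e | e | e
    · simp only [hf, e, hI, Matrix.one_mul, hsq]
    · simp only [hf, e, hI, Matrix.mul_one, hsq]
    · simp only [hf, e, hsq, Matrix.mul_one]
  have hff : tensor f * tensor f = siteOp r (f r * f r) * siteOp p (-1) := by
    rw [tensor_mul, siteOp.eq_def p, siteOp_mul_tensor]
    congr 1
    funext t
    rcases eq_or_ne t r with rfl | ht
    · simp [hpr.symm]
    · rw [Function.update_of_ne ht]
      rcases eq_or_ne t p with rfl | ht'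
      · simpa using hfp
      · rw [Function.update_of_ne ht', hft t ht' ht]
  have hr : f r * f r = -1 := by
    have h1 : siteOp r (f r * f r + 1) * Φ = 0 := by
      have h2 : tensor f * tensor f * Φ = Φ := by rw [Matrix.mul_assoc, hfΦ, hfΦ]
      rw [hff, siteOp_neg, siteOp_one, Matrix.mul_neg, Matrix.mul_one, Matrix.neg_mul] at h2
      rw [siteOp_add, siteOp_one, Matrix.add_mul, Matrix.one_mul]
      nth_rewrite 2 [← h2]
      exact add_neg_cancel _
    exact eq_neg_of_add_eq_zero_left (hfaithful _ h1)
  have hflip : O r (g r) * O r (h r) = -(O r (h r) * O r (g r)) := by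
    calc O r (g r) * O r (h r)
        = f r * f r * (O r (h r) * O r (g r)) := by
          simp only [hf, Matrix.mul_assoc]
          rw [← Matrix.mul_assoc (O r (h r)) (O r (h r)), hsq, Matrix.one_mul, hsq, Matrix.mul_one]
      _ = -(O r (h r) * O r (g r)) := by rw [hr, Matrix.neg_mul, Matrix.one_mul]
  rcases hcase _ _ ((hclash r).2 (.inr rfl)) with ⟨e1, e2⟩ | ⟨e1, e2⟩
  · rwa [e1, e2] at hflip
  · rw [e1, e2] at hflip
    rw [hflip, neg_neg]

/-- Anticommutation spreads from the first site to all the others. -/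
lemma anticommute_of_fixed {E : Type} {Φ : Matrix (∀ i, a i) E ℂ}
    {O : ∀ i, Pauli → Matrix (a i) (a i) ℂ} (hI : ∀ i, O i .I = 1)
    (hsq : ∀ i L, O i L * O i L = 1)
    (hfix : ∀ i ∈ Finset.Icc 1 (kMin N), (tensor fun p => O p (maxGen N i p)) * Φ = Φ)
    (hfaithful : ∀ (p : Fin N) (M : Matrix (a p) (a p) ℂ), siteOp p M * Φ = 0 → M = 0)
    (hzero : ∀ p : Fin N, p.val = 0 → O p .X * O p .Z = -(O p .Z * O p .X)) (p : Fin N) :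
    O p .X * O p .Z = -(O p .Z * O p .X) := by
  obtain ⟨s, hs⟩ := p
  induction s with
  | zero => exact hzero _ rfl
  | succ s ih =>
    obtain ⟨i, hi, j, hj, h⟩ := exists_clash_iff hs
    refine anticommute_of_clash hI hsq (hfix i hi) (hfix j hj) (p := ⟨s, by omega⟩)
      (r := ⟨s + 1, hs⟩) (by simp) (fun t => ?_) (ih _) (hfaithful _)
    rw [h, Fin.ext_iff, Fin.ext_iff]

end Propagation

/-! ### The local unitaries -/

section LocalUnitaries

variable {N : ℕ} {d : Fin N → ℕ} {A : ∀ i, Fin 2 → Matrix (Fin (d i)) (Fin (d i)) ℂ}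
  {E : Type} [Fintype E] {Φ : Matrix (∀ i, Fin (d i)) E ℂ}

/-- The compressions of the operators of the parties to the supports of the reduced states are
involutions, which fix the compressed state and anticommute at every site. The local unitaries turn
them into Pauli matrices. -/
lemma exists_local_unitaries (hN : 2 ≤ N) (hA : ∀ i x, IsDichotomic (A i x))
    (hfix : ∀ i ∈ Finset.Icc 1 (kMin N), genObs A i * Φ = Φ) :
    ∃ (n : Fin N → ℕ) (U : ∀ i, Matrix (Fin 2 × Fin (n i)) (Fin (d i)) ℂ),
      (∀ i, IsUnitaryOnSupport (U i) (localState (Φ * Φᴴ) i)) ∧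
      (∀ i ∈ Finset.Icc 1 (kMin N),
        (tensor fun p => (maxGen N i p).toMatrix ⊗ₖ (1 : Matrix (Fin (n p)) (Fin (n p)) ℂ)) *
          (tensor U * Φ) = tensor U * Φ) ∧
      (tensor U * Φ)ᴴ * (tensor U * Φ) = Φᴴ * Φ := by
  choose r W hW hrange using fun p =>
    exists_isometry_range_eq (LinearMap.range (localState (Φ * Φᴴ) p).mulVecLin)
  have hWρ : ∀ p, W p * (W p)ᴴ * localState (Φ * Φᴴ) p = localState (Φ * Φᴴ) p := fun p =>
    mul_conjTranspose_mul_of_range_le (hW p) (hrange p).ge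
  have hWΦ : (tensor fun p => W p * (W p)ᴴ) * Φ = Φ :=
    tensor_mul_eq_self (a := fun i => Fin (d i)) _ Φ fun p =>
      (siteOp_mul_eq_self_iff Φ p _).2 (hWρ p)
  let O : ∀ p, Pauli → Matrix (Fin (r p)) (Fin (r p)) ℂ :=
    fun p L => (W p)ᴴ * letterOp A p L * W p
  let Φ' : Matrix (∀ p, Fin (r p)) E ℂ := (tensor fun p => (W p)ᴴ) * Φ
  have hspec : ∀ p L, W p * O p L = letterOp A p L * W p ∧ O p L * O p L = 1 := fun p L =>
    compression_spec (hW p) (hrange p)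
      ((siteOp_mul_eq_self_iff Φ p _).1 (siteOp_letterOp_sq hN hA hfix p L))
      (letterOp_preserves_support hN hA hfix p L (hWρ p))
  have hOI : ∀ p, O p .I = 1 := fun p => by
    simp only [O, letterOp, Matrix.mul_one, hW]
  have hOH : ∀ p L, (O p L)ᴴ = O p L := fun p L => by
    simp only [O, Matrix.conjTranspose_mul, Matrix.conjTranspose_conjTranspose,
      letterOp_conjTranspose hA, Matrix.mul_assoc]
  have hOfix : ∀ i ∈ Finset.Icc 1 (kMin N),
      (tensor fun p => O p (maxGen N i p)) * Φ' = Φ' := by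
    intro i hi
    have h1 : (tensor fun p => O p (maxGen N i p)) * (tensor fun p => (W p)ᴴ) =
        (tensor fun p => (W p)ᴴ) * (genObs A i * tensor fun p => W p * (W p)ᴴ) := by
      rw [genObs, tensor_mul, tensor_mul, tensor_mul]
      simp only [O, Matrix.mul_assoc]
    simp only [Φ']
    rw [← Matrix.mul_assoc, h1, Matrix.mul_assoc, Matrix.mul_assoc, hWΦ, hfix i hi]
  have hfaithful : ∀ (p : Fin N) (M : Matrix (Fin (r p)) (Fin (r p)) ℂ),
      siteOp (a := fun i => Fin (r i)) p M * Φ' = 0 → M = 0 := by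
    intro p M hM
    have h1 : tensor W * (siteOp (a := fun i => Fin (r i)) p M * tensor fun p => (W p)ᴴ) =
        siteOp (a := fun i => Fin (d i)) p (W p * M * (W p)ᴴ) *
          tensor fun p => W p * (W p)ᴴ := by
      rw [siteOp_mul_tensor (a := fun i => Fin (r i)), siteOp_mul_tensor (a := fun i => Fin (d i)),
        tensor_mul]
      congr 1
      funext t
      rcases eq_or_ne t p with rfl | ht
      · simp only [Function.update_self, Matrix.mul_assoc]
        rw [← Matrix.mul_assoc (W t)ᴴ (W t), hW, Matrix.one_mul]
      · simp only [Function.update_of_ne ht]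
    have h2 : siteOp (a := fun i => Fin (d i)) p (W p * M * (W p)ᴴ) * Φ = 0 := by
      rw [← hWΦ, ← Matrix.mul_assoc, ← h1, Matrix.mul_assoc, Matrix.mul_assoc, hM,
        Matrix.mul_zero]
    rw [siteOp_mul_eq_zero_iff] at h2
    obtain ⟨C, hC⟩ := exists_eq_mul_of_range_le (hrange p).le
    have h3 : W p * M * (W p)ᴴ * W p = 0 := by
      nth_rewrite 3 [hC]
      rw [← Matrix.mul_assoc, h2, Matrix.zero_mul]
    calc M = (W p)ᴴ * (W p * M * (W p)ᴴ * W p) := by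
          simp only [Matrix.mul_assoc, hW, Matrix.mul_one]
          rw [← Matrix.mul_assoc, hW, Matrix.one_mul]
      _ = 0 := by rw [h3, Matrix.mul_zero]
  have hzero : ∀ p : Fin N, p.val = 0 → O p .X * O p .Z = -(O p .Z * O p .X) := by
    intro p hp
    have h1 : ∀ L L', O p L * O p L' = (W p)ᴴ * (letterOp A p L * letterOp A p L') * W p := by
      intro L L'
      calc O p L * O p L' = (W p)ᴴ * letterOp A p L * (W p * O p L') := by
            simp only [O, Matrix.mul_assoc]
        _ = _ := by rw [(hspec p L').1]; simp only [Matrix.mul_assoc]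
    rw [h1, h1, letterOp_anticommute hA hp, Matrix.mul_neg, Matrix.neg_mul]
  have hanti := anticommute_of_fixed (a := fun i => Fin (r i)) hOI (fun p L => (hspec p L).2)
    hOfix hfaithful hzero
  choose n V hV1 hV2 hVX hVZ using fun p => exists_unitary_of_anticommute (hOH p .X) (hOH p .Z)
    (hspec p .X).2 (hspec p .Z).2 (hanti p)
  have hVO : ∀ p L, V p * O p L =
      (L.toMatrix ⊗ₖ (1 : Matrix (Fin (n p)) (Fin (n p)) ℂ)) * V p := by
    intro p L
    cases L
    · rw [hOI, Matrix.mul_one, Pauli.toMatrix, Matrix.one_kronecker_one, Matrix.one_mul]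
    · exact hVX p
    · exact hVZ p
  have hUΦ : (tensor fun p => V p * (W p)ᴴ) * Φ = tensor V * Φ' := by
    simp only [Φ', ← tensor_mul, Matrix.mul_assoc]
  refine ⟨n, fun p => V p * (W p)ᴴ, fun p => ⟨?_, ?_⟩, fun i hi => ?_, ?_⟩
  · rw [Matrix.conjTranspose_mul, Matrix.conjTranspose_conjTranspose, Matrix.mul_assoc,
      ← Matrix.mul_assoc (W p)ᴴ, hW, Matrix.one_mul, hV1]
  · have hsurj : LinearMap.range ((V p)ᴴ).mulVecLin = ⊤ := by
      rw [LinearMap.range_eq_top]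
      intro v
      exact ⟨(V p).mulVec v, by simp [Matrix.mulVec_mulVec, hV2]⟩
    rw [Matrix.conjTranspose_mul, Matrix.conjTranspose_conjTranspose, Matrix.mulVecLin_mul,
      LinearMap.range_comp, hsurj, Submodule.map_top, hrange]
  · rw [hUΦ, ← Matrix.mul_assoc, tensor_mul]
    simp only [← hVO]
    rw [← tensor_mul, Matrix.mul_assoc, hOfix i hi]
  · have h1 : (tensor fun p => V p * (W p)ᴴ)ᴴ * (tensor fun p => V p * (W p)ᴴ) =
        tensor fun p => W p * (W p)ᴴ := by
      rw [tensor_conjTranspose, tensor_mul]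
      congr 1
      funext p
      rw [Matrix.conjTranspose_mul, Matrix.conjTranspose_conjTranspose, Matrix.mul_assoc,
        ← Matrix.mul_assoc (V p)ᴴ, hV2, Matrix.one_mul]
    rw [Matrix.conjTranspose_mul, Matrix.mul_assoc, ← Matrix.mul_assoc _ _ Φ, h1, hWΦ]

end LocalUnitaries

/-! ### Expansion in a basis of the stabilizer subspace -/

section Expansion

variable {N : ℕ} {n : Fin N → ℕ}

/-- The qubit vector that a vector of `⨂_i (ℂ² ⊗ ℂ^{n_i}) ⊗ H_E` has as its component for the basis
vector `z` of the other factors. -/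
noncomputable def qubitSlice {E : Type} (Ψ : Matrix (∀ i, Fin 2 × Fin (n i)) E ℂ)
    (z : (∀ i, Fin (n i)) × E) : EuclideanSpace ℂ (Fin N → Fin 2) :=
  WithLp.toLp 2 fun x => Ψ (fun i => (x i, z.1 i)) z.2

lemma mulVec_qubitSlice {E : Type} (σ : Fin N → Matrix (Fin 2) (Fin 2) ℂ)
    (Ψ : Matrix (∀ i, Fin 2 × Fin (n i)) E ℂ) (z : (∀ i, Fin (n i)) × E) :
    Matrix.toEuclideanLin (tensor σ) (qubitSlice Ψ z) =
      qubitSlice ((tensor fun p => σ p ⊗ₖ (1 : Matrix (Fin (n p)) (Fin (n p)) ℂ)) * Ψ) z := by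
  ext x
  simp only [Matrix.toLpLin_apply, qubitSlice, Matrix.mulVec, dotProduct, Matrix.mul_apply]
  rw [← (Equiv.arrowProdEquivProdArrow (Fin N) (fun _ => Fin 2) fun i => Fin (n i)).symm.sum_comp,
    Fintype.sum_prod_type]
  refine Finset.sum_congr rfl fun y _ => ?_
  rw [Finset.sum_eq_single z.1]
  · simp [tensor, Equiv.arrowProdEquivProdArrow]
  · intro w _ hw
    obtain ⟨i, hi⟩ := Function.ne_iff.1 hw
    rw [tensor, Finset.prod_eq_zero (Finset.mem_univ i), zero_mul]
    simp [Equiv.arrowProdEquivProdArrow, hi.symm]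
  · simp

lemma qubitSlice_mem_maxSubspace {E : Type} {Ψ : Matrix (∀ i, Fin 2 × Fin (n i)) E ℂ}
    (h : ∀ i ∈ Finset.Icc 1 (kMin N),
      (tensor fun p => (maxGen N i p).toMatrix ⊗ₖ (1 : Matrix (Fin (n p)) (Fin (n p)) ℂ)) * Ψ = Ψ)
    (z : (∀ i, Fin (n i)) × E) : qubitSlice Ψ z ∈ maxSubspace N := by
  simp only [maxSubspace, Submodule.mem_iInf]
  intro i hi
  rw [Module.End.mem_eigenspace_iff, mulVec_qubitSlice, h i hi, one_smul]

lemma sum_norm_sq_qubitSlice {E : Type} [Fintype E] (Ψ : Matrix (∀ i, Fin 2 × Fin (n i)) E ℂ) :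
    ∑ z, ‖qubitSlice Ψ z‖ ^ 2 = (Ψᴴ * Ψ).trace.re := by
  simp only [EuclideanSpace.norm_sq_eq, qubitSlice]
  simp only [Matrix.trace, Matrix.diag, Matrix.mul_apply, Matrix.conjTranspose_apply,
    Complex.re_sum]
  rw [Fintype.sum_prod_type, Finset.sum_comm]
  refine Finset.sum_congr rfl fun c _ => ?_
  rw [← (Equiv.arrowProdEquivProdArrow (Fin N) (fun _ => Fin 2) fun i => Fin (n i)).symm.sum_comp,
    Fintype.sum_prod_type, Finset.sum_comm]
  refine Finset.sum_congr rfl fun x _ => Finset.sum_congr rfl fun y _ => ?_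
  rw [Complex.star_def, Complex.conj_mul', ← Complex.ofReal_pow, Complex.ofReal_re]
  rfl

/-- A unit vector all of whose qubit components lie in the span of an orthonormal family is a
superposition of products with the members of the family. -/
lemma exists_expansion {e m : ℕ} {Ψ : Matrix (∀ i, Fin 2 × Fin (n i)) (Fin e) ℂ}
    (hΨ : (Ψᴴ * Ψ).trace.re = 1) {ψ : Fin m → EuclideanSpace ℂ (Fin N → Fin 2)}
    (hψ : Orthonormal ℂ ψ) (hmem : ∀ z, qubitSlice Ψ z ∈ Submodule.span ℂ (Set.range ψ)) :
    ∃ (α : Fin m → ℝ) (ξ : Fin m → EuclideanSpace ℂ ((∀ i, Fin (n i)) × Fin e)),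
      (∀ j, 0 ≤ α j) ∧ ∑ j, α j ^ 2 = 1 ∧ (∀ j, ‖ξ j‖ = 1) ∧
      WithLp.toLp 2 (fun y : (∀ i, Fin 2 × Fin (n i)) × Fin e => Ψ y.1 y.2) =
        ∑ j, (α j : ℂ) • prodState (ψ j) (ξ j) := by
  have hslice : ∀ z, ∃ c : Fin m → ℂ, ∑ j, c j • ψ j = qubitSlice Ψ z := fun z =>
    (Submodule.mem_span_range_iff_exists_fun ℂ).1 (hmem z)
  choose c hc using hslice
  let ζ : Fin m → EuclideanSpace ℂ ((∀ i, Fin (n i)) × Fin e) :=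
    fun j => WithLp.toLp 2 fun z => c z j
  have hnorm : ∀ z, ‖qubitSlice Ψ z‖ ^ 2 = ∑ j, ‖c z j‖ ^ 2 := by
    intro z
    have h1 := hψ.inner_sum (c z) (c z) Finset.univ
    rw [hc, inner_self_eq_norm_sq_to_K] at h1
    have h2 := congrArg Complex.re h1
    simpa [Complex.conj_mul', ← Complex.ofReal_pow] using h2
  have hζ : ∑ j, ‖ζ j‖ ^ 2 = 1 := by
    rw [← hΨ, ← sum_norm_sq_qubitSlice]
    simp only [hnorm, EuclideanSpace.norm_sq_eq, ζ]
    exact Finset.sum_comm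
  -- if a coefficient vanishes, any unit vector will do
  have hunit : ∃ u : EuclideanSpace ℂ ((∀ i, Fin (n i)) × Fin e), ‖u‖ = 1 := by
    have hne : Nonempty ((∀ i, Fin (n i)) × Fin e) := by
      by_contra hempty
      rw [not_nonempty_iff] at hempty
      simp [← sum_norm_sq_qubitSlice] at hΨ
    obtain ⟨z⟩ := hne
    classical
    exact ⟨EuclideanSpace.single z 1, by simp⟩
  obtain ⟨u, hu⟩ := hunit
  refine ⟨fun j => ‖ζ j‖, fun j => if ζ j = 0 then u else ((‖ζ j‖ : ℂ))⁻¹ • ζ j,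
    fun j => norm_nonneg _, hζ, fun j => ?_, ?_⟩
  · beta_reduce
    split_ifs with h
    · exact hu
    · rw [norm_smul, norm_inv, Complex.norm_real, norm_norm, inv_mul_cancel₀ (norm_ne_zero_iff.2 h)]
  · have hscale : ∀ j, ((‖ζ j‖ : ℝ) : ℂ) • prodState (n := n) (ψ j)
        (if ζ j = 0 then u else ((‖ζ j‖ : ℂ))⁻¹ • ζ j) = prodState (ψ j) (ζ j) := by
      intro j
      ext y
      split_ifs with h
      · simp [prodState, h]
      · have h' : (‖ζ j‖ : ℂ) ≠ 0 := by simpa using h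
        simp only [prodState, PiLp.smul_apply, smul_eq_mul]
        field_simp
    simp only [hscale]
    ext y
    have h1 := congrArg (fun v : EuclideanSpace ℂ (Fin N → Fin 2) => v fun i => (y.1 i).1)
      (hc (fun i => (y.1 i).2, y.2))
    simp only [qubitSlice] at h1
    simp only [WithLp.ofLp_sum, Finset.sum_apply, prodState, ζ]
    rw [← h1]
    simp only [WithLp.ofLp_sum, Finset.sum_apply, PiLp.smul_apply, smul_eq_mul, mul_comm]

lemma toEuclideanLin_kronecker_one {e : ℕ} {p q : Type} [Fintype p] [Fintype q] [DecidableEq p]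
    (M : Matrix q p ℂ) (φ : EuclideanSpace ℂ (p × Fin e)) :
    Matrix.toEuclideanLin (M ⊗ₖ (1 : Matrix (Fin e) (Fin e) ℂ)) φ =
      WithLp.toLp 2 fun y : q × Fin e => (M * Matrix.of fun x c => φ (x, c)) y.1 y.2 := by
  ext ⟨y, c⟩
  simp only [Matrix.toLpLin_apply, Matrix.mulVec, dotProduct, Matrix.mul_apply,
    Fintype.sum_prod_type, Matrix.kroneckerMap_apply, Matrix.one_apply]
  simp

end Expansion

end SubspaceSelfTest

/-- Every quantum behaviour at which the Bell expression `I_N^max` attains its maximum over all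
quantum behaviours self-tests the subspace `V_N^max`. -/
theorem theorem4 (N : ℕ) (hN : 2 ≤ N) (P : SubspaceSelfTest.Behaviour N)
    (hP : P ∈ SubspaceSelfTest.quantumSet N)
    (hmax : ∀ P' ∈ SubspaceSelfTest.quantumSet N,
      SubspaceSelfTest.bellExpr N P' ≤ SubspaceSelfTest.bellExpr N P) :
    SubspaceSelfTest.SelfTests P (SubspaceSelfTest.maxSubspace N) := by
  intro d e φ A hφ hA hcorr
  obtain ⟨P', hP', hval⟩ := SubspaceSelfTest.exists_quantum_bellExpr_eq hN
  have hviol := hmax P' hP'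
  let Φ : Matrix (∀ i, Fin (d i)) (Fin e) ℂ := Matrix.of fun x c => φ (x, c)
  have hρ : SubspaceSelfTest.reducedState φ = Φ * Φ.conjTranspose := rfl
  rw [hval, ← hcorr, hρ] at hviol
  have htr : (Φ.conjTranspose * Φ).trace = 1 := by
    have h1 : ∑ x, ‖φ x‖ ^ 2 = 1 := by rw [← EuclideanSpace.norm_sq_eq, hφ, one_pow]
    have h2 : (Φ.conjTranspose * Φ).trace = ((∑ x, ‖φ x‖ ^ 2 : ℝ) : ℂ) := by
      rw [Fintype.sum_prod_type, Finset.sum_comm]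
      push_cast
      refine Finset.sum_congr rfl fun c _ => ?_
      rw [Matrix.diag, Matrix.mul_apply]
      exact Finset.sum_congr rfl fun x _ => Complex.conj_mul' _
    rw [h2, h1, Complex.ofReal_one]
  have hfix := fun i hi => SubspaceSelfTest.genObs_mul_eq_self hN hA
    (by rw [Matrix.trace_mul_comm, htr]) hviol (i := i) hi
  obtain ⟨n, U, hU, hUfix, hUnorm⟩ := SubspaceSelfTest.exists_local_unitaries hN hA hfix
  refine ⟨n, U, hU, fun m ψ hψ hspan => ?_⟩
  rw [SubspaceSelfTest.toEuclideanLin_kronecker_one]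
  refine SubspaceSelfTest.exists_expansion (Ψ := SubspaceSelfTest.tensor U * Φ)
    (by rw [hUnorm, htr, Complex.one_re]) hψ fun z => ?_
  rw [hspan]
  exact SubspaceSelfTest.qubitSlice_mem_maxSubspace hUfix z
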